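/- Let $1\le m<n$ be integers, let $\boldsymbol\epsilon\sim N(\boldsymbol\mu,\mathbf I_n)$ with $\boldsymbol\mu\in\mathbb R^n$ arbitrary, let $\mathbf A=\mathrm{diag}(\mathbf I_m,\mathbf 0)$, $\mathbf B=\mathbf I_n$, and let $$R=\frac{\boldsymbol\epsilon'\mathbf A\boldsymbol\epsilon}{\boldsymbol\epsilon'\mathbf B\boldsymbol\epsilon}$$ (a noncentral Beta$(\frac m2,\frac{n-m}2)$ ratio). For $0<r<1$ let $X_r=\boldsymbol\epsilon'(\mathbf A-r\mathbf B)\boldsymbol\epsilon$, with moment generating function $M_{X_r}$ and cumulant generating function $K_{X_r}=\ln M_{X_r}$, and let $\lambda_1(r)$ and $\lambda_n(r)$ be the smallest and largest eigenvalues of $\mathbf A-r\mathbf B$. The equation $K_{X_r}'(s)=0$ has a unique root $\hat s$ in $\bigl(\frac1{2\lambda_1(r)},\frac1{2\lambda_n(r)}\bigr)$. Put $\hat w=\mathrm{sgn}(\hat s)\sqrt{-2K_{X_r}(\hat s)}$, $\hat u=\hat s\sqrt{K_{X_r}''(\hat s)}$. With $\Phi,\phi$ the standard normal distribution and density functions,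 the first-order Lugannani–Rice approximation is $$\widehat{\Pr}_1(R\le r)=\begin{cases}\Phi(\hat w)+\phi(\hat w)\{\hat w^{-1}-\hat u^{-1}\},& E[X_r]\ne0,\\ \frac12+\dfrac{K_{X_r}'''(0)}{6\sqrt{2\pi}\,K_{X_r}''(0)^{3/2}},& E[X_r]=0,\end{cases}$$ with $\widehat{\Pr}_1(R>r)=1-\widehat{\Pr}_1(R\le r)$, and the first-order saddlepoint density is $$\hat f_R(r)=\frac{J_r(\hat s)}{\sqrt{2\pi K_{X_r}''(\hat s)}}M_{X_r}(\hat s),\qquad J_r(s)=\mathrm{tr}\{\mathbf G_s\mathbf B\}+\boldsymbol\mu'\mathbf G_s\mathbf B\mathbf G_s\boldsymbol\mu,\quad \mathbf G_s=\{\mathbf I_n-2s(\mathbf A-r\mathbf B)\}^{-1}.$$ Let $\theta=\sum_{i=1}^m\mu_i^2$ and $$t_0=\frac12+\frac1{4n}\Bigl\{(\theta-m)-\sqrt{(\theta-m)^2+4\theta n}\Bigr\},\qquad \eta_2=\frac{\theta}{2(1-2t_0)},$$ $$u_0=\sqrt{\frac{n-m}2+2t_0^2\Bigl\{\frac m{(1-2t_0)^2}+\frac{2\theta}{(1-2t_0)^3}\Bigr\}},$$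 $$RE=\frac{\sqrt{2\pi}\,(1-2t_0)^{m/2}(2t_0)^{(n-m)/2}\,u_0\,e^{-\eta_2}}{B(\frac m2,\frac{n-m}2)\,\frac{n-m}2}\;{}_1F_1\Bigl(\frac n2;\frac m2;\frac\theta2\Bigr),$$ where $B(\cdot,\cdot)$ is the Beta function and ${}_1F_1(a;b;z)=\sum_{k\ge0}\frac{(a)_k}{(b)_k}\frac{z^k}{k!}$. Then, as $r\uparrow1$ (the right edge of the support of $R$), $$\frac{\Pr(R>r)}{\widehat{\Pr}_1(R>r)}\to RE .$$ Moreover $R$ has a density $f_R$ that is continuous on $(0,1)$, and $f_R(r)/\hat f_R(r)\to RE$ as $r\uparrow1$. -/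

import Mathlib

open MeasureTheory ProbabilityTheory Set Filter Topology Matrix

namespace QuadRatio

noncomputable section

/-! ### Ratios of quadratic forms in a Gaussian vector -/

/-- The quadratic form `ε' M ε` of a random vector `ε = (ε₁, …, εₙ)`. -/
def quadForm {n : ℕ} {Ω : Type*} (M : Matrix (Fin n) (Fin n) ℝ) (ε : Fin n → Ω → ℝ)
    (ω : Ω) : ℝ :=
  (fun i => ε i ω) ⬝ᵥ (M *ᵥ fun i => ε i ω)

/-- The ratio `R = ε' A ε / ε' B ε`. -/
def ratio {n : ℕ} {Ω : Type*} (A B : Matrix (Fin n) (Fin n) ℝ) (ε : Fin n → Ω → ℝ)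
    (ω : Ω) : ℝ :=
  quadForm A ε ω / quadForm B ε ω

/-- `ε ~ N(μ, I_n)`: independent coordinates, the `i`-th one with law `N(μ_i, 1)`. -/
structure IsGaussianVector {n : ℕ} {Ω : Type*} [MeasurableSpace Ω] (ε : Fin n → Ω → ℝ)
    (μ : Fin n → ℝ) (P : Measure Ω) : Prop where
  law : ∀ i, HasLaw (ε i) (gaussianReal (μ i) 1) P
  indep : iIndepFun ε P

/-- `X_r = ε' (A - r B) ε`. -/
def formX {n : ℕ} {Ω : Type*} (A B : Matrix (Fin n) (Fin n) ℝ) (ε : Fin n → Ω → ℝ)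
    (r : ℝ) : Ω → ℝ :=
  quadForm (A - r • B) ε

/-- `K_{X_r}(s)`, the cumulant generating function of `X_r`. -/
def cumulant {n : ℕ} {Ω : Type*} [MeasurableSpace Ω] (A B : Matrix (Fin n) (Fin n) ℝ)
    (ε : Fin n → Ω → ℝ) (P : Measure Ω) (r : ℝ) : ℝ → ℝ :=
  cgf (formX A B ε r) P

/-! ### The saddlepoint -/

/-- The interval `(1 / (2 λ₁), 1 / (2 λₙ))`, where `λ₁` and `λₙ` are the smallest and the largest
eigenvalue of `A - r B`. -/
def strip {n : ℕ} (A B : Matrix (Fin n) (Fin n) ℝ) (r : ℝ) : Set ℝ :=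
  Ioo (1 / (2 * sInf (spectrum ℝ (A - r • B)))) (1 / (2 * sSup (spectrum ℝ (A - r • B))))

/-- `s` is a saddlepoint at `r`: a root of `K'_{X_r}` in the interval above. -/
def IsSaddlepoint {n : ℕ} {Ω : Type*} [MeasurableSpace Ω] (A B : Matrix (Fin n) (Fin n) ℝ)
    (ε : Fin n → Ω → ℝ) (P : Measure Ω) (r s : ℝ) : Prop :=
  s ∈ strip A B r ∧ deriv (cumulant A B ε P r) s = 0

/-- The saddlepoint `ŝ` at `r` (an arbitrary number if there is no saddlepoint). -/
def saddlepoint {n : ℕ} {Ω : Type*} [MeasurableSpace Ω] (A B : Matrix (Fin n) (Fin n) ℝ)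
    (ε : Fin n → Ω → ℝ) (P : Measure Ω) (r : ℝ) : ℝ :=
  Classical.epsilon fun s => IsSaddlepoint A B ε P r s

/-! ### The first-order Lugannani–Rice approximation -/

/-- `ŵ = sgn(ŝ) √(-2 K(ŝ))`. -/
def wHat {n : ℕ} {Ω : Type*} [MeasurableSpace Ω] (A B : Matrix (Fin n) (Fin n) ℝ)
    (ε : Fin n → Ω → ℝ) (P : Measure Ω) (r : ℝ) : ℝ :=
  Real.sign (saddlepoint A B ε P r) *
    √(-2 * cumulant A B ε P r (saddlepoint A B ε P r))

/-- `û = ŝ √(K''(ŝ))`. -/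
def uHat {n : ℕ} {Ω : Type*} [MeasurableSpace Ω] (A B : Matrix (Fin n) (Fin n) ℝ)
    (ε : Fin n → Ω → ℝ) (P : Measure Ω) (r : ℝ) : ℝ :=
  saddlepoint A B ε P r *
    √(iteratedDeriv 2 (cumulant A B ε P r) (saddlepoint A B ε P r))

open Classical in
/-- The first-order Lugannani–Rice approximation to `Pr(R ≤ r)`. -/
def lugannaniRice {n : ℕ} {Ω : Type*} [MeasurableSpace Ω] (A B : Matrix (Fin n) (Fin n) ℝ)
    (ε : Fin n → Ω → ℝ) (P : Measure Ω) (r : ℝ) : ℝ :=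
  if ∫ ω, formX A B ε r ω ∂P = 0 then
    1 / 2 + iteratedDeriv 3 (cumulant A B ε P r) 0 /
      (6 * √(2 * Real.pi) * (iteratedDeriv 2 (cumulant A B ε P r) 0) ^ (3 / 2 : ℝ))
  else
    cdf (gaussianReal 0 1) (wHat A B ε P r) +
      gaussianPDFReal 0 1 (wHat A B ε P r) * ((wHat A B ε P r)⁻¹ - (uHat A B ε P r)⁻¹)

/-- The first-order Lugannani–Rice approximation to the right tail `Pr(R > r)`. -/
def lugannaniRiceTail {n : ℕ} {Ω : Type*} [MeasurableSpace Ω]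
    (A B : Matrix (Fin n) (Fin n) ℝ) (ε : Fin n → Ω → ℝ) (P : Measure Ω) (r : ℝ) : ℝ :=
  1 - lugannaniRice A B ε P r

/-! ### The first-order saddlepoint density -/

/-- The factor `J_r(s)`, written without diagonalizing `A - r B`; `saddleFactor_eq` is the form in
terms of an orthogonal diagonalization. -/
def saddleFactor {n : ℕ} (A B : Matrix (Fin n) (Fin n) ℝ) (μ : Fin n → ℝ) (r s : ℝ) : ℝ :=
  ((1 - (2 * s) • (A - r • B))⁻¹ * B).trace +
    μ ⬝ᵥ (((1 - (2 * s) • (A - r • B))⁻¹ * B * (1 - (2 * s) • (A - r • B))⁻¹) *ᵥ μ)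

/-- If `A - r B = P' Λ P` with `P` orthogonal and `Λ` diagonal, `H = P B P'` and `ν = P μ`, then
`J_r(s) = tr (I - 2sΛ)⁻¹ H + ν' (I - 2sΛ)⁻¹ H (I - 2sΛ)⁻¹ ν`. -/
theorem saddleFactor_eq {n : ℕ} (A B P : Matrix (Fin n) (Fin n) ℝ) (lam μ : Fin n → ℝ)
    (r s : ℝ) (hP : P * Pᵀ = 1) (hD : A - r • B = Pᵀ * diagonal lam * P) :
    saddleFactor A B μ r s =
      ((1 - (2 * s) • diagonal lam)⁻¹ * (P * B * Pᵀ)).trace +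
        (P *ᵥ μ) ⬝ᵥ (((1 - (2 * s) • diagonal lam)⁻¹ * (P * B * Pᵀ) *
          (1 - (2 * s) • diagonal lam)⁻¹) *ᵥ (P *ᵥ μ)) := by
  have hP' : Pᵀ * P = 1 := mul_eq_one_comm.mp hP
  have h1 : (1 - (2 * s) • (A - r • B) : Matrix (Fin n) (Fin n) ℝ) =
      Pᵀ * (1 - (2 * s) • diagonal lam) * P := by
    rw [hD, mul_sub, sub_mul, mul_one, hP', mul_smul_comm, smul_mul_assoc]
  have hPi : P⁻¹ = Pᵀ := inv_eq_right_inv hP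
  have hPti : (Pᵀ)⁻¹ = P := inv_eq_right_inv hP'
  have h2 : (1 - (2 * s) • (A - r • B) : Matrix (Fin n) (Fin n) ℝ)⁻¹ =
      Pᵀ * (1 - (2 * s) • diagonal lam)⁻¹ * P := by
    rw [h1, Matrix.mul_inv_rev, Matrix.mul_inv_rev, hPi, hPti, mul_assoc]
  unfold saddleFactor
  rw [h2]
  generalize (1 - (2 * s) • diagonal lam : Matrix (Fin n) (Fin n) ℝ)⁻¹ = E
  congr 1
  · rw [mul_assoc, mul_assoc, trace_mul_comm]
    simp only [mul_assoc]
  · rw [← vecMul_transpose P μ, ← dotProduct_mulVec, vecMul_transpose, mulVec_mulVec,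
      mulVec_mulVec]
    simp only [mul_assoc]

/-- The first-order saddlepoint density `f̂_R(r) = J_r(ŝ) M_{X_r}(ŝ) / √(2π K''(ŝ))`. -/
def saddleDensity {n : ℕ} {Ω : Type*} [MeasurableSpace Ω] (A B : Matrix (Fin n) (Fin n) ℝ)
    (μ : Fin n → ℝ) (ε : Fin n → Ω → ℝ) (P : Measure Ω) (r : ℝ) : ℝ :=
  saddleFactor A B μ r (saddlepoint A B ε P r) /
      √(2 * Real.pi * iteratedDeriv 2 (cumulant A B ε P r) (saddlepoint A B ε P r)) *
    mgf (formX A B ε r) P (saddlepoint A B ε P r)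

/-- `f` is a probability density of `Y` that is continuous on `I`. -/
structure IsContinuousDensityOn {Ω : Type*} [MeasurableSpace Ω] (Y : Ω → ℝ) (P : Measure Ω)
    (I : Set ℝ) (f : ℝ → ℝ) : Prop where
  measurable : Measurable f
  nonneg : ∀ x, 0 ≤ f x
  continuousOn : ContinuousOn f I
  law : HasLaw Y (volume.withDensity fun x => ENNReal.ofReal (f x)) P

/-! ### The beta case -/

/-- The block matrix `diag(I_m, 0)` of size `n`. -/
def betaA (n m : ℕ) : Matrix (Fin n) (Fin n) ℝ :=
  diagonal fun i => if i.val < m then 1 else 0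

/-- `θ = μ₁² + … + μ_m²`. -/
def theta {n : ℕ} (m : ℕ) (μ : Fin n → ℝ) : ℝ :=
  ∑ i with i.val < m, μ i ^ 2

/-- Kummer's confluent hypergeometric function `₁F₁(a; b; z) = ∑ₖ (a)ₖ / (b)ₖ * zᵏ / k!`. -/
def kummer (a b z : ℝ) : ℝ :=
  ∑' k : ℕ, (ascPochhammer ℝ k).eval a / (ascPochhammer ℝ k).eval b * (z ^ k / k.factorial)

/-- The limit `t₀` of `(1 - r) ŝ`. -/
def tZero (n m : ℕ) (θ : ℝ) : ℝ :=
  1 / 2 + 1 / (4 * n) * ((θ - m) - √((θ - m) ^ 2 + 4 * θ * n))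

/-- The limit `u₀` of `û`. -/
def uZero (n m : ℕ) (θ : ℝ) : ℝ :=
  √(((n : ℝ) - m) / 2 +
    2 * tZero n m θ ^ 2 *
      (m / (1 - 2 * tZero n m θ) ^ 2 + 2 * θ / (1 - 2 * tZero n m θ) ^ 3))

/-- `η₂ = θ / (2 (1 - 2 t₀))`. -/
def etaTwo (n m : ℕ) (θ : ℝ) : ℝ :=
  θ / (2 * (1 - 2 * tZero n m θ))

/-- The limiting ratio. -/
def limitRE (n m : ℕ) (θ : ℝ) : ℝ :=
  √(2 * Real.pi) * (1 - 2 * tZero n m θ) ^ ((m : ℝ) / 2) *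
      (2 * tZero n m θ) ^ (((n : ℝ) - m) / 2) * uZero n m θ * Real.exp (-etaTwo n m θ) /
    (beta ((m : ℝ) / 2) (((n : ℝ) - m) / 2) * (((n : ℝ) - m) / 2)) *
    kummer ((n : ℝ) / 2) ((m : ℝ) / 2) (θ / 2)

end

end QuadRatio

open QuadRatio

open QuadRatio

namespace QuadRatio

/-! ### Laws determined by the moment generating function near the origin -/

/-! Put a = m/2, b = (n-m)/2, and let τ be the sum of the squared means of the last n-m coordinates.
Then R = Y/(Y+Z) and X_r = (1-r)Y - rZ, where Y and Z are independent noncentral chi-squares with 2a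
and 2b degrees of freedom and noncentralities θ and τ. Exact and approximate quantities decay at the
same power rate at the edge, so RE is a quotient of leading constants.

Exact side: R has density (1-r)^(b-1) r^(-b-1) I((1-r)/r) with I continuous (`hasLaw_ratioDensity`,
`continuous_ratioIntegral`). Hence f_R ~ I(0)(1-r)^(b-1) and Pr(R > r) ~ (I(0)/b)(1-r)^b, and I(0)
is a Kummer function (`ratioIntegral_zero`).

Approximate side: ŝ is of order 1/(1-r), and (1-r)ŝ tends to t₀ (`tendsto_scaled_saddlepoint`). So
M(ŝ) ~ C(1-r)^b and û → u₀, while ŵ → ∞. Since φ(ŵ) = M(ŝ)/√(2π) and the Mills ratio vanishes, the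
Lugannani–Rice tail is asymptotic to φ(ŵ)/û (`tendsto_lugannaniRice_tail`). The saddlepoint equation
gives (1-r) ŝ J_r(ŝ) → b, so the saddlepoint density has constant b times that of the tail, and both
quotients have the same limit. The factor exp(-τ/2) is common to both sides and cancels
(`limitRE_eq`). -/

theorem measure_ext_of_mgf_eventuallyEq {ν ν' : Measure ℝ} [IsFiniteMeasure ν] [IsFiniteMeasure ν']
    (h0 : (0 : ℝ) ∈ interior (integrableExpSet id ν))
    (h0' : (0 : ℝ) ∈ interior (integrableExpSet id ν'))
    (h : mgf id ν =ᶠ[𝓝 0] mgf id ν') : ν = ν' := by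
  set U : Set ℝ := interior (integrableExpSet id ν) ∩ interior (integrableExpSet id ν') with hU
  have hX : AnalyticOnNhd ℂ (complexMGF id ν) {z | z.re ∈ U} := fun z hz =>
    analyticOnNhd_complexMGF z hz.1
  have hY : AnalyticOnNhd ℂ (complexMGF id ν') {z | z.re ∈ U} := fun z hz =>
    analyticOnNhd_complexMGF z hz.2
  have hconv : Convex ℝ U :=
    (convex_integrableExpSet (X := id) (μ := ν)).interior.inter
      (convex_integrableExpSet (X := id) (μ := ν')).interior
  have hreal : ∃ᶠ x : ℝ in 𝓝[≠] 0, complexMGF id ν x = complexMGF id ν' x := by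
    refine Eventually.frequently ?_
    filter_upwards [h.filter_mono nhdsWithin_le_nhds] with x hx
    rw [complexMGF_ofReal, complexMGF_ofReal, hx]
  have hfreq : ∃ᶠ z in 𝓝[≠] ((0 : ℝ) : ℂ), complexMGF id ν z = complexMGF id ν' z := by
    rw [frequently_iff_seq_forall] at hreal ⊢
    obtain ⟨xs, hx_tendsto, hx_eq⟩ := hreal
    refine ⟨fun n => xs n, ?_, fun n => by simp [hx_eq]⟩
    rw [tendsto_nhdsWithin_iff] at hx_tendsto ⊢
    refine ⟨(Complex.continuous_ofReal.tendsto 0).comp hx_tendsto.1, by simpa using hx_tendsto.2⟩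
  -- Identity theorem: agreement near 0 on the real axis spreads to the vertical strip over `U`. The
  -- strip contains the imaginary axis, where the complex MGF is the characteristic function.
  have heq : EqOn (complexMGF id ν) (complexMGF id ν') {z | z.re ∈ U} :=
    AnalyticOnNhd.eqOn_of_preconnected_of_frequently_eq hX hY
      (hconv.linear_preimage Complex.reLm).isPreconnected
      (z₀ := ((0 : ℝ) : ℂ)) (by simp [hU, h0, h0']) hfreq
  refine Measure.ext_of_charFun (funext fun t => ?_)
  rw [← complexMGF_id_mul_I, ← complexMGF_id_mul_I]
  exact heq (by simp [hU, h0, h0'])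

/-! ### Squares of Gaussian variables -/

/-- The moment generating function of a noncentral chi-square law with `2 a` degrees of freedom
and noncentrality `τ`. -/
noncomputable def chiSqMgf (a τ t : ℝ) : ℝ :=
  (1 - 2 * t) ^ (-a) * Real.exp (τ * t / (1 - 2 * t))

theorem chiSqMgf_pos {t : ℝ} (a τ : ℝ) (ht : t < 1 / 2) : 0 < chiSqMgf a τ t := by
  have : 0 < 1 - 2 * t := by linarith
  unfold chiSqMgf
  positivity

theorem mgf_sq_gaussianReal (μ : ℝ) {t : ℝ} (ht : t < 1 / 2) :
    mgf (fun x => x ^ 2) (gaussianReal μ 1) t = chiSqMgf (1 / 2) (μ ^ 2) t := by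
  have h1 : 0 < 1 - 2 * t := by linarith
  unfold mgf
  rw [integral_gaussianReal_eq_integral_smul one_ne_zero]
  -- Completing the square turns the integrand into a Gaussian centred at μ/(1-2t).
  have hpt : ∀ x : ℝ, gaussianPDFReal μ 1 x • Real.exp (t * x ^ 2) =
      (√(2 * Real.pi))⁻¹ * Real.exp (μ ^ 2 * t / (1 - 2 * t)) *
        Real.exp (-((1 - 2 * t) / 2) * (x - μ / (1 - 2 * t)) ^ 2) := by
    intro x
    rw [gaussianPDFReal, smul_eq_mul, mul_assoc _ (Real.exp _) (Real.exp _),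
      mul_assoc _ (Real.exp _) (Real.exp _), ← Real.exp_add, ← Real.exp_add]
    simp only [NNReal.coe_one, mul_one]
    congr 2
    field_simp
    ring
  simp_rw [hpt]
  rw [integral_const_mul,
    integral_sub_right_eq_self (fun x => Real.exp (-((1 - 2 * t) / 2) * x ^ 2)),
    integral_gaussian, chiSqMgf, Real.rpow_neg h1.le, ← Real.sqrt_eq_rpow]
  have : Real.pi / ((1 - 2 * t) / 2) = 2 * Real.pi / (1 - 2 * t) := by field_simp
  rw [this, Real.sqrt_div (by positivity)]
  have : √(2 * Real.pi) ≠ 0 := by positivity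
  have : √(1 - 2 * t) ≠ 0 := by positivity
  field_simp

/-- `∑_{i ∈ S} ε_i²`. -/
def sqSum {n : ℕ} {Ω : Type*} (ε : Fin n → Ω → ℝ) (S : Finset (Fin n)) (ω : Ω) : ℝ :=
  ∑ i ∈ S, ε i ω ^ 2

variable {n : ℕ} {Ω : Type*} [MeasurableSpace Ω] {P : Measure Ω} {μ : Fin n → ℝ} {ε : Fin n → Ω → ℝ}

theorem IsGaussianVector.aemeasurable (h : IsGaussianVector ε μ P) (i : Fin n) :
    AEMeasurable (ε i) P := (h.law i).aemeasurable

theorem IsGaussianVector.aemeasurable_sqSum (h : IsGaussianVector ε μ P) (S : Finset (Fin n)) :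
    AEMeasurable (sqSum ε S) P := by
  unfold sqSum
  exact Finset.aemeasurable_fun_sum _ fun i _ => (h.aemeasurable i).pow_const 2

theorem IsGaussianVector.mgf_sqSum (h : IsGaussianVector ε μ P) (S : Finset (Fin n)) {t : ℝ}
    (ht : t < 1 / 2) :
    mgf (sqSum ε S) P t = chiSqMgf (S.card / 2) (∑ i ∈ S, μ i ^ 2) t := by
  have h1 : 0 < 1 - 2 * t := by linarith
  have hind : iIndepFun (fun i ω => ε i ω ^ 2) P :=
    h.indep.comp (fun _ x => x ^ 2) fun _ => measurable_id.pow_const 2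
  have hs : sqSum ε S = ∑ i ∈ S, fun ω => ε i ω ^ 2 := by
    ext ω; simp [sqSum]
  rw [hs, hind.mgf_sum₀ (fun i => (h.aemeasurable i).pow_const 2)]
  have hi : ∀ i ∈ S, mgf (fun ω => ε i ω ^ 2) P t = chiSqMgf (1 / 2) (μ i ^ 2) t := by
    intro i _
    rw [← mgf_sq_gaussianReal _ ht, ← (h.law i).map_eq, mgf_map (h.aemeasurable i)
      (by fun_prop)]
    rfl
  rw [Finset.prod_congr rfl hi]
  unfold chiSqMgf
  rw [Finset.prod_mul_distrib, Finset.prod_const, ← Real.exp_sum, ← Real.rpow_natCast,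
    ← Real.rpow_mul h1.le, Finset.sum_mul, Finset.sum_div]
  congr 2
  ring

theorem IsGaussianVector.indepFun_sqSum (h : IsGaussianVector ε μ P) {S T : Finset (Fin n)}
    (hST : Disjoint S T) : IndepFun (sqSum ε S) (sqSum ε T) P := by
  have := h.indep.indepFun_finset₀ S T hST h.aemeasurable
  have hm : ∀ S : Finset (Fin n), Measurable fun x : S → ℝ => ∑ i, x i ^ 2 := fun S => by fun_prop
  have key := this.comp (hm S) (hm T)
  have e : ∀ S : Finset (Fin n), ((fun x : S → ℝ => ∑ i, x i ^ 2) ∘ fun a (i : S) => ε i a) =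
      sqSum ε S := fun S => by
    ext ω
    simp only [sqSum, Function.comp_apply]
    exact Finset.sum_coe_sort S fun i => ε i ω ^ 2
  rwa [e, e] at key

/-! ### Noncentral chi-square densities -/

/-- Ratio test: successive terms have quotient z/(a+j), at most 1/2 once j ≥ 2z. This series
dominates the kernel uniformly in q. -/
theorem summable_pow_div_Gamma {a : ℝ} (ha : 0 < a) {z : ℝ} (hz : 0 ≤ z) :
    Summable fun j : ℕ => z ^ j / Real.Gamma (a + j) := by
  refine summable_of_ratio_norm_eventually_le (r := 1 / 2) (by norm_num) ?_
  filter_upwards [eventually_ge_atTop ⌈2 * z⌉₊] with j hj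
  have hj' : 2 * z ≤ j := (Nat.le_ceil _).trans (by exact_mod_cast hj)
  have hp : 0 < a + j := by positivity
  have hG : 0 < Real.Gamma (a + j) := Real.Gamma_pos_of_pos hp
  have e : Real.Gamma (a + (j + 1 : ℕ)) = (a + j) * Real.Gamma (a + j) := by
    rw [← Real.Gamma_add_one hp.ne']; push_cast; ring_nf
  rw [e, Real.norm_of_nonneg (by positivity), Real.norm_of_nonneg (by positivity), pow_succ,
    div_le_iff₀ (by positivity)]
  have : 1 / 2 * (z ^ j / Real.Gamma (a + j)) * ((a + j) * Real.Gamma (a + j)) =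
      z ^ j * ((a + j) / 2) := by field_simp
  rw [this]
  gcongr
  linarith

/-- The `j`-th summand of `chiSqKernel`. -/
noncomputable def chiSqTerm (a τ : ℝ) (j : ℕ) (q : ℝ) : ℝ :=
  (τ / 2) ^ j / (j.factorial * Real.Gamma (a + j)) * ((|q| / 2) ^ j * Real.exp (-(|q| / 2)))

/-- On the positive half-line, the density of a noncentral chi-square law with `2 a` degrees of
freedom and noncentrality `τ` is `q ^ (a - 1) * chiSqKernel a τ q`. -/
noncomputable def chiSqKernel (a τ q : ℝ) : ℝ :=
  2 ^ (-a) * Real.exp (-(τ / 2)) * ∑' j, chiSqTerm a τ j q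

section

variable {a τ : ℝ} (ha : 0 < a) (hτ : 0 ≤ τ)
include ha hτ

theorem chiSqTerm_nonneg (j : ℕ) (q : ℝ) : 0 ≤ chiSqTerm a τ j q := by
  have : 0 < Real.Gamma (a + j) := Real.Gamma_pos_of_pos (by positivity)
  unfold chiSqTerm
  positivity

/-- The inequality x^j/j! ≤ e^x absorbs the factorial; the absolute value in `chiSqTerm` makes the
bound uniform on the whole line. -/
theorem chiSqTerm_le (j : ℕ) (q : ℝ) : chiSqTerm a τ j q ≤ (τ / 2) ^ j / Real.Gamma (a + j) := by
  have hG : 0 < Real.Gamma (a + j) := Real.Gamma_pos_of_pos (by positivity)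
  have hf : (0 : ℝ) < j.factorial := by positivity
  have h := Real.pow_div_factorial_le_exp (|q| / 2) (by positivity) j
  have h' : (|q| / 2) ^ j * Real.exp (-(|q| / 2)) ≤ j.factorial := by
    rw [Real.exp_neg, ← div_eq_mul_inv, div_le_iff₀ (Real.exp_pos _)]
    rw [div_le_iff₀ hf] at h
    linarith
  unfold chiSqTerm
  calc _ ≤ (τ / 2) ^ j / (j.factorial * Real.Gamma (a + j)) * j.factorial := by gcongr
    _ = _ := by field_simp

theorem summable_chiSqTerm (q : ℝ) : Summable fun j => chiSqTerm a τ j q :=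
  (summable_pow_div_Gamma ha (by positivity)).of_nonneg_of_le
    (fun j => chiSqTerm_nonneg ha hτ j q) (fun j => chiSqTerm_le ha hτ j q)

theorem continuous_chiSqKernel : Continuous (chiSqKernel a τ) := by
  unfold chiSqKernel
  refine continuous_const.mul (continuous_tsum (fun j => ?_)
    (summable_pow_div_Gamma ha (z := τ / 2) (by positivity)) fun j q => ?_)
  · unfold chiSqTerm; fun_prop
  · rw [Real.norm_of_nonneg (chiSqTerm_nonneg ha hτ j q)]
    exact chiSqTerm_le ha hτ j q

theorem chiSqKernel_nonneg (q : ℝ) : 0 ≤ chiSqKernel a τ q :=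
  mul_nonneg (by positivity) (tsum_nonneg fun j => chiSqTerm_nonneg ha hτ j q)

theorem exists_chiSqKernel_le : ∃ C, ∀ q, chiSqKernel a τ q ≤ C := by
  refine ⟨2 ^ (-a) * Real.exp (-(τ / 2)) * ∑' j : ℕ, (τ / 2) ^ j / Real.Gamma (a + j), fun q => ?_⟩
  unfold chiSqKernel
  gcongr
  · exact summable_chiSqTerm ha hτ q
  · exact summable_pow_div_Gamma ha (by positivity)
  · exact chiSqTerm_le ha hτ _ q

end

theorem chiSqKernel_zero (a τ : ℝ) :
    chiSqKernel a τ 0 = 2 ^ (-a) * Real.exp (-(τ / 2)) / Real.Gamma a := by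
  unfold chiSqKernel
  rw [tsum_eq_single 0]
  · simp [chiSqTerm, div_eq_mul_inv]
  · intro j hj
    simp [chiSqTerm, hj]

theorem lintegral_rpow_mul_exp_neg {s b : ℝ} (hs : 0 < s) (hb : 0 < b) :
    ∫⁻ x in Ioi (0 : ℝ), ENNReal.ofReal (x ^ (s - 1) * Real.exp (-(b * x))) =
      ENNReal.ofReal (b ^ (-s) * Real.Gamma s) := by
  have hi : IntegrableOn (fun x : ℝ => x ^ (s - 1) * Real.exp (-(b * x))) (Ioi 0) := by
    have := integrableOn_rpow_mul_exp_neg_mul_rpow (s := s - 1) (p := 1) (by linarith) one_pos hb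
    simpa [neg_mul] using this
  rw [← ofReal_integral_eq_lintegral_ofReal hi, Real.integral_rpow_mul_exp_neg_mul_Ioi hs hb,
    one_div, Real.inv_rpow hb.le, Real.rpow_neg hb.le]
  filter_upwards [ae_restrict_mem measurableSet_Ioi] with x hx
  have : 0 < x := hx
  simp only [Pi.zero_apply]
  positivity

/-- The `j`-th summand of `∫ x ^ c * exp (t * x)` against a noncentral chi-square density. -/
noncomputable def chiSqMoment (a τ c t : ℝ) (j : ℕ) : ℝ :=
  2 ^ (-a) * Real.exp (-(τ / 2)) * ((τ / 2) ^ j / (j.factorial * Real.Gamma (a + j)) *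
    ((1 / 2) ^ j * ((1 / 2 - t) ^ (-(a + j + c)) * Real.Gamma (a + j + c))))

section

variable {a τ c t : ℝ} (ha : 0 < a) (hτ : 0 ≤ τ) (hc : 0 ≤ c) (ht : t < 1 / 2)
include ha hτ hc ht

theorem chiSqMoment_nonneg (j : ℕ) : 0 ≤ chiSqMoment a τ c t j := by
  have h1 : 0 < Real.Gamma (a + j) := Real.Gamma_pos_of_pos (by positivity)
  have h2 : 0 < Real.Gamma (a + j + c) := Real.Gamma_pos_of_pos (by positivity)
  have h3 : 0 < 1 / 2 - t := by linarith
  unfold chiSqMoment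
  positivity

/-- Tonelli: all terms are nonnegative, and each is a Gamma integral of shape a+j+c and rate 1/2-t.
-/
theorem lintegral_chiSqKernel :
    ∫⁻ x in Ioi (0 : ℝ), ENNReal.ofReal
      (x ^ c * Real.exp (t * x) * (x ^ (a - 1) * chiSqKernel a τ x)) =
      ∑' j, ENNReal.ofReal (chiSqMoment a τ c t j) := by
  have h3 : 0 < 1 / 2 - t := by linarith
  have hpt : ∀ x ∈ Ioi (0 : ℝ), ENNReal.ofReal
      (x ^ c * Real.exp (t * x) * (x ^ (a - 1) * chiSqKernel a τ x)) =
      ∑' j : ℕ, ENNReal.ofReal (2 ^ (-a) * Real.exp (-(τ / 2)) *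
        ((τ / 2) ^ j / (j.factorial * Real.Gamma (a + j)) * (1 / 2) ^ j)) *
        ENNReal.ofReal (x ^ (a + j + c - 1) * Real.exp (-((1 / 2 - t) * x))) := by
    intro x hx
    have hx : 0 < x := hx
    unfold chiSqKernel
    rw [← tsum_mul_left, ← tsum_mul_left, ← tsum_mul_left, ENNReal.ofReal_tsum_of_nonneg]
    · congr 1
      ext j
      have h1 : 0 < Real.Gamma (a + j) := Real.Gamma_pos_of_pos (by positivity)
      rw [← ENNReal.ofReal_mul (by positivity)]
      congr 1
      have e1 : x ^ (a + j + c - 1) = x ^ c * x ^ (a - 1) * x ^ j := by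
        rw [← Real.rpow_natCast, ← Real.rpow_add hx, ← Real.rpow_add hx]
        ring_nf
      have e2 : Real.exp (-((1 / 2 - t) * x)) = Real.exp (t * x) * Real.exp (-(x / 2)) := by
        rw [← Real.exp_add]; ring_nf
      rw [e1, e2, chiSqTerm, abs_of_pos hx, div_pow]
      ring
    · intro j
      have := chiSqTerm_nonneg ha hτ j x
      positivity
    · exact (((summable_chiSqTerm ha hτ x).mul_left _).mul_left _).mul_left _
  rw [setLIntegral_congr_fun measurableSet_Ioi hpt, lintegral_tsum fun j => by fun_prop]
  congr 1
  ext j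
  have h1 : 0 < Real.Gamma (a + j) := Real.Gamma_pos_of_pos (by positivity)
  rw [lintegral_const_mul _ (by fun_prop), lintegral_rpow_mul_exp_neg (by positivity) h3,
    ← ENNReal.ofReal_mul (by positivity), chiSqMoment]
  congr 1
  ring

/-- Finiteness of the sum yields integrability. It is used with c = 0 for the MGF and with t = 0, c
= b for the moment in the edge constant. -/
theorem integral_chiSqKernel {T : ℝ} (hT : HasSum (chiSqMoment a τ c t) T) :
    IntegrableOn (fun x => x ^ c * Real.exp (t * x) * (x ^ (a - 1) * chiSqKernel a τ x)) (Ioi 0) ∧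
    ∫ x in Ioi (0 : ℝ), x ^ c * Real.exp (t * x) * (x ^ (a - 1) * chiSqKernel a τ x) = T := by
  have hT0 : 0 ≤ T := hT.nonneg (chiSqMoment_nonneg ha hτ hc ht)
  have hl : ∫⁻ x in Ioi (0 : ℝ), ENNReal.ofReal
      (x ^ c * Real.exp (t * x) * (x ^ (a - 1) * chiSqKernel a τ x)) = ENNReal.ofReal T := by
    rw [lintegral_chiSqKernel ha hτ hc ht, ← ENNReal.ofReal_tsum_of_nonneg
      (chiSqMoment_nonneg ha hτ hc ht) hT.summable, hT.tsum_eq]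
  have hm : Measurable fun x => x ^ c * Real.exp (t * x) * (x ^ (a - 1) * chiSqKernel a τ x) := by
    have := (continuous_chiSqKernel ha hτ).measurable
    fun_prop
  have hnn : 0 ≤ᵐ[volume.restrict (Ioi 0)]
      fun x => x ^ c * Real.exp (t * x) * (x ^ (a - 1) * chiSqKernel a τ x) := by
    filter_upwards [ae_restrict_mem measurableSet_Ioi] with x hx
    have : 0 < x := hx
    have := chiSqKernel_nonneg ha hτ x
    simp only [Pi.zero_apply]
    positivity
  refine ⟨⟨hm.aestronglyMeasurable, ?_⟩, ?_⟩
  · rw [hasFiniteIntegral_iff_ofReal hnn, hl]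
    exact ENNReal.ofReal_lt_top
  · rw [integral_eq_lintegral_of_nonneg_ae hnn hm.aestronglyMeasurable, hl,
      ENNReal.toReal_ofReal hT0]

end

/-- At c = 0 the Gamma factors cancel, leaving the exponential series at τ/(2(1-2t)). -/
theorem hasSum_chiSqMoment_mgf {a τ t : ℝ} (ha : 0 < a) (ht : t < 1 / 2) :
    HasSum (chiSqMoment a τ 0 t) (chiSqMgf a τ t) := by
  have h1 : 0 < 1 - 2 * t := by linarith
  have h := (NormedSpace.expSeries_div_hasSum_exp (τ / 2 / (1 - 2 * t))).mul_left
    ((1 - 2 * t) ^ (-a) * Real.exp (-(τ / 2)))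
  rw [← Real.exp_eq_exp_ℝ, mul_assoc, ← Real.exp_add] at h
  have e : -(τ / 2) + τ / 2 / (1 - 2 * t) = τ * t / (1 - 2 * t) := by field_simp; ring
  rw [e] at h
  refine h.congr_fun ?_
  intro j
  have hG : Real.Gamma (a + j) ≠ 0 := (Real.Gamma_pos_of_pos (by positivity)).ne'
  have e1 : (1 / 2 - t) = (1 - 2 * t) * 2⁻¹ := by ring
  have h2 : (2 : ℝ) ^ a * 2 ^ (-a) = 1 := by rw [← Real.rpow_add two_pos]; simp
  have e2 : (1 / 2 - t) ^ (-(a + j + 0)) =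
      (1 - 2 * t) ^ (-a) * ((1 - 2 * t) ^ j)⁻¹ * (2 ^ a * 2 ^ j) := by
    rw [e1, Real.mul_rpow h1.le (by norm_num), Real.inv_rpow two_pos.le,
      ← Real.rpow_neg two_pos.le, neg_neg, add_zero, neg_add, Real.rpow_add h1,
      Real.rpow_neg h1.le (j : ℝ), Real.rpow_natCast, Real.rpow_add two_pos, Real.rpow_natCast]
  have h2j : (2 : ℝ) ^ j ≠ 0 := by positivity
  rw [chiSqMoment, e2, add_zero, one_div, inv_pow, div_pow, div_pow, div_pow]
  generalize (2 : ℝ) ^ j = w at *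
  field_simp
  linear_combination (τ ^ j) * h2

theorem Gamma_add_natCast {s : ℝ} (hs : 0 < s) (j : ℕ) :
    Real.Gamma (s + j) = (ascPochhammer ℝ j).eval s * Real.Gamma s := by
  induction j with
  | zero => simp
  | succ j ih =>
    have hp : s + j ≠ 0 := by positivity
    rw [ascPochhammer_succ_eval, Nat.cast_succ, ← add_assoc, Real.Gamma_add_one hp, ih]
    ring

theorem summable_kummer {A a z : ℝ} (hA : 0 < A) (ha : 0 < a) (hz : 0 ≤ z) :
    Summable fun k : ℕ => (ascPochhammer ℝ k).eval A / (ascPochhammer ℝ k).eval a *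
      (z ^ k / k.factorial) := by
  refine summable_of_ratio_norm_eventually_le (r := 1 / 2) (by norm_num) ?_
  -- The quotient of successive terms is (A+j)/(a+j) · z/(j+1), and its first factor is at most A/a
  -- + 1.
  filter_upwards [eventually_ge_atTop ⌈2 * z * (A / a + 1)⌉₊] with j hj
  have hj' : 2 * z * (A / a + 1) ≤ j := (Nat.le_ceil _).trans (by exact_mod_cast hj)
  have h1 := ascPochhammer_pos j A hA
  have h2 := ascPochhammer_pos j a ha
  have hrat : (A + j) / (a + j) ≤ A / a + 1 := by
    rw [div_le_iff₀ (by positivity)]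
    have : (A / a + 1) * (a + j) = A + j + a + A / a * j := by field_simp; ring
    rw [this]
    have : 0 ≤ A / a * j := by positivity
    linarith
  rw [ascPochhammer_succ_eval, ascPochhammer_succ_eval, Real.norm_of_nonneg (by positivity),
    Real.norm_of_nonneg (by positivity), Nat.factorial_succ, pow_succ]
  push_cast
  have e : (ascPochhammer ℝ j).eval A * (A + j) / ((ascPochhammer ℝ j).eval a * (a + j)) *
      (z ^ j * z / ((j + 1) * j.factorial)) =
      ((A + j) / (a + j) * z / (j + 1)) * ((ascPochhammer ℝ j).eval A / (ascPochhammer ℝ j).eval a *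
      (z ^ j / j.factorial)) := by
    field_simp
  rw [e]
  refine mul_le_mul_of_nonneg_right ?_ (by positivity)
  rw [div_le_iff₀ (by positivity)]
  have := mul_le_mul_of_nonneg_right hrat hz
  linarith

/-- Γ(a+c+j)/Γ(a+j) is Γ(a+c)/Γ(a) times the quotient of Pochhammer symbols, which is the Kummer
coefficient. -/
theorem hasSum_chiSqMoment_kummer {a τ c : ℝ} (ha : 0 < a) (hτ : 0 ≤ τ) (hc : 0 ≤ c) :
    HasSum (chiSqMoment a τ c 0) (2 ^ c * Real.exp (-(τ / 2)) *
      (Real.Gamma (a + c) / Real.Gamma a) * kummer (a + c) a (τ / 2)) := by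
  have h := (summable_kummer (A := a + c) (by positivity) ha
    (z := τ / 2) (by positivity)).hasSum.mul_left
    (2 ^ c * Real.exp (-(τ / 2)) * (Real.Gamma (a + c) / Real.Gamma a))
  refine h.congr_fun ?_
  intro j
  have hG : Real.Gamma a ≠ 0 := (Real.Gamma_pos_of_pos ha).ne'
  have h2 := ascPochhammer_pos j a ha
  have h3 : (2 : ℝ) ^ a * 2 ^ (-a) = 1 := by rw [← Real.rpow_add two_pos]; simp
  have e2 : (1 / 2 - 0 : ℝ) ^ (-(a + j + c)) = 2 ^ a * 2 ^ j * 2 ^ c := by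
    rw [sub_zero, one_div, Real.inv_rpow two_pos.le, ← Real.rpow_neg two_pos.le, neg_neg,
      Real.rpow_add two_pos, Real.rpow_add two_pos, Real.rpow_natCast]
  rw [chiSqMoment, e2, show a + j + c = (a + c) + j by ring, Gamma_add_natCast ha,
    Gamma_add_natCast (by positivity : 0 < a + c), one_div, inv_pow, div_pow]
  have h2j : (2 : ℝ) ^ j ≠ 0 := by positivity
  generalize (2 : ℝ) ^ j = w at *
  field_simp
  linear_combination τ ^ j * (Polynomial.eval (a + c) (ascPochhammer ℝ j)) * h3

/-- The noncentral chi-square law. -/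
noncomputable def chiSqLaw (a τ : ℝ) : Measure ℝ :=
  (volume.restrict (Ioi 0)).withDensity fun q => ENNReal.ofReal (q ^ (a - 1) * chiSqKernel a τ q)

theorem measurable_chiSqDensity {a τ : ℝ} (ha : 0 < a) (hτ : 0 ≤ τ) :
    Measurable fun q => ENNReal.ofReal (q ^ (a - 1) * chiSqKernel a τ q) := by
  have := (continuous_chiSqKernel ha hτ).measurable
  fun_prop

theorem chiSqLaw_exp {a τ t : ℝ} (ha : 0 < a) (hτ : 0 ≤ τ) (ht : t < 1 / 2) :
    t ∈ integrableExpSet id (chiSqLaw a τ) ∧ mgf id (chiSqLaw a τ) t = chiSqMgf a τ t := by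
  obtain ⟨hi, he⟩ := integral_chiSqKernel ha hτ le_rfl ht (hasSum_chiSqMoment_mgf ha ht)
  have hpos : ∀ᵐ q ∂volume.restrict (Ioi (0 : ℝ)), (0 : ℝ) ≤ q ^ (a - 1) * chiSqKernel a τ q := by
    filter_upwards [ae_restrict_mem measurableSet_Ioi] with x hx
    have : 0 < x := hx
    have := chiSqKernel_nonneg ha hτ x
    positivity
  have hlt : ∀ᵐ q ∂volume.restrict (Ioi (0 : ℝ)),
      ENNReal.ofReal (q ^ (a - 1) * chiSqKernel a τ q) < ⊤ := by simp
  have hfun : (fun x => (ENNReal.ofReal (x ^ (a - 1) * chiSqKernel a τ x)).toReal •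
      Real.exp (t * id x)) =ᵐ[volume.restrict (Ioi (0 : ℝ))]
      fun x => x ^ (0 : ℝ) * Real.exp (t * x) * (x ^ (a - 1) * chiSqKernel a τ x) := by
    filter_upwards [hpos] with x hx
    rw [ENNReal.toReal_ofReal hx, smul_eq_mul, Real.rpow_zero, id]
    ring
  constructor
  · change Integrable (fun x => Real.exp (t * id x)) (chiSqLaw a τ)
    unfold chiSqLaw
    rw [integrable_withDensity_iff_integrable_smul' (measurable_chiSqDensity ha hτ) hlt]
    exact (integrable_congr hfun).mpr hi
  · unfold mgf chiSqLaw
    rw [integral_withDensity_eq_integral_toReal_smul (measurable_chiSqDensity ha hτ) hlt,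
      integral_congr_ae hfun, he]

theorem hasLaw_chiSqLaw {Ω : Type*} [MeasurableSpace Ω] {P : Measure Ω} [IsProbabilityMeasure P]
    {Y : Ω → ℝ} (hY : AEMeasurable Y P) {a τ : ℝ} (ha : 0 < a) (hτ : 0 ≤ τ)
    (h : ∀ t < 1 / 2, mgf Y P t = chiSqMgf a τ t) : HasLaw Y (chiSqLaw a τ) P := by
  refine ⟨hY, ?_⟩
  have : IsProbabilityMeasure (P.map Y) := Measure.isProbabilityMeasure_map hY
  have hm : ∀ t, mgf id (P.map Y) t = mgf Y P t := fun t => congrFun (mgf_id_map hY) t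
  -- A non-integrable exponential would give the default MGF value 0, so positivity certifies
  -- integrability.
  have h1 : Iio (1 / 2 : ℝ) ⊆ integrableExpSet id (P.map Y) := fun t ht => by
    have : 0 < mgf id (P.map Y) t := by rw [hm, h t ht]; exact chiSqMgf_pos a τ ht
    exact mgf_pos_iff.mp this
  have h2 : Iio (1 / 2 : ℝ) ⊆ integrableExpSet id (chiSqLaw a τ) := fun t ht =>
    (chiSqLaw_exp ha hτ ht).1
  have : IsFiniteMeasure (chiSqLaw a τ) := by
    have h0 : (0 : ℝ) ∈ integrableExpSet id (chiSqLaw a τ) := h2 (by norm_num)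
    have : Integrable (fun x => Real.exp (0 * id x)) (chiSqLaw a τ) := h0
    simpa [integrable_const_iff] using this
  have hn : Iio (1 / 2 : ℝ) ∈ 𝓝 0 := Iio_mem_nhds (by norm_num)
  refine measure_ext_of_mgf_eventuallyEq (mem_interior_iff_mem_nhds.mpr (mem_of_superset hn h1))
    (mem_interior_iff_mem_nhds.mpr (mem_of_superset hn h2)) ?_
  filter_upwards [hn] with t ht
  rw [hm, h t ht, (chiSqLaw_exp ha hτ ht).2]

/-! ### The density of a ratio of noncentral chi-square variables -/

/-- `E[Y ^ b * chiSqKernel b τ (c * Y)]` for `Y` noncentral chi-square with parameters `a`, `θ`. -/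
noncomputable def ratioIntegral (a b θ τ c : ℝ) : ℝ :=
  ∫ x in Ioi (0 : ℝ), x ^ b * (x ^ (a - 1) * chiSqKernel a θ x) * chiSqKernel b τ (c * x)

/-- The density of `Y₁ / (Y₁ + Y₂)` for independent noncentral chi-square variables. -/
noncomputable def ratioDensity (a b θ τ : ℝ) : ℝ → ℝ :=
  (Ioo 0 1).indicator fun r =>
    (1 - r) ^ (b - 1) / r ^ (b + 1) * ratioIntegral a b θ τ ((1 - r) / r)

/-- At c = 0 the second kernel is the constant 2^(-b) exp(-τ/2)/Γ(b), and what remains is E[Y^b]. -/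
theorem ratioIntegral_zero {a b θ τ : ℝ} (ha : 0 < a) (hb : 0 < b) (hθ : 0 ≤ θ) :
    ratioIntegral a b θ τ 0 =
      Real.exp (-(θ / 2)) * Real.exp (-(τ / 2)) / beta a b * kummer (a + b) a (θ / 2) := by
  have h := (integral_chiSqKernel ha hθ hb.le (by norm_num : (0 : ℝ) < 1 / 2)
    (hasSum_chiSqMoment_kummer ha hθ hb.le)).2
  simp only [zero_mul, Real.exp_zero, mul_one] at h
  unfold ratioIntegral
  simp only [zero_mul]
  rw [integral_mul_const, h, chiSqKernel_zero, beta]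
  have h1 := (Real.Gamma_pos_of_pos ha).ne'
  have h2 := (Real.Gamma_pos_of_pos hb).ne'
  have h3 := (Real.Gamma_pos_of_pos (add_pos ha hb)).ne'
  have h4 : (2 : ℝ) ^ b * 2 ^ (-b) = 1 := by rw [← Real.rpow_add two_pos]; simp
  field_simp
  linear_combination (kummer (a + b) a (θ / 2)) * h4

/-- Substitution y = x(1-r)/r, for which x/(x+y) = r and |dy/dr| = x/r². -/
theorem lintegral_ratio_inner (b τ : ℝ) {x : ℝ} (hx : 0 < x) (φ : ℝ → ENNReal) :
    ∫⁻ y in Ioi (0 : ℝ), ENNReal.ofReal (y ^ (b - 1) * chiSqKernel b τ y) * φ (x / (x + y)) =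
      ∫⁻ r in Ioo (0 : ℝ) 1, ENNReal.ofReal (x / r ^ 2 *
        ((x * ((1 - r) / r)) ^ (b - 1) * chiSqKernel b τ ((1 - r) / r * x))) * φ r := by
  have himg : (fun r : ℝ => x * ((1 - r) / r)) '' Ioo 0 1 = Ioi 0 := by
    ext y
    constructor
    · rintro ⟨r, hr, rfl⟩
      have h1 : 0 < 1 - r := by linarith [hr.2]
      have h2 := hr.1
      exact mem_Ioi.mpr (by positivity)
    · intro hy
      have hy : 0 < y := hy
      refine ⟨x / (x + y), ⟨by positivity, ?_⟩, ?_⟩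
      · rw [div_lt_one (by positivity)]; linarith
      · have : x + y ≠ 0 := by positivity
        simp only
        field_simp
        ring
  have hderiv : ∀ r ∈ Ioo (0 : ℝ) 1,
      HasDerivWithinAt (fun r : ℝ => x * ((1 - r) / r)) (-(x / r ^ 2)) (Ioo 0 1) r := by
    intro r hr
    have h2 : r ≠ 0 := hr.1.ne'
    have := ((((hasDerivAt_id r).const_sub 1).div (hasDerivAt_id r) h2).const_mul x)
    refine (this.congr_deriv ?_).hasDerivWithinAt
    simp only [id]
    field_simp
    ring
  have hinj : InjOn (fun r : ℝ => x * ((1 - r) / r)) (Ioo 0 1) := by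
    intro r hr s hs h
    have h1 : r ≠ 0 := hr.1.ne'
    have h2 : s ≠ 0 := hs.1.ne'
    simp only at h
    field_simp at h
    linarith
  rw [← himg, lintegral_image_eq_lintegral_abs_deriv_mul measurableSet_Ioo hderiv hinj]
  refine setLIntegral_congr_fun measurableSet_Ioo fun r hr => ?_
  have h1 : 0 < r := hr.1
  have h2 : 0 < 1 - r := by linarith [hr.2]
  have e : x / (x + x * ((1 - r) / r)) = r := by field_simp; ring
  rw [e, ← mul_assoc, ← ENNReal.ofReal_mul (abs_nonneg _), abs_neg,
    abs_of_pos (by positivity : 0 < x / r ^ 2), mul_comm x ((1 - r) / r)]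

section

variable {a b θ τ : ℝ} (ha : 0 < a) (hb : 0 < b) (hθ : 0 ≤ θ) (hτ : 0 ≤ τ)
include ha hb hθ

theorem integrableOn_rpow_mul_chiSqKernel :
    IntegrableOn (fun x : ℝ => x ^ b * (x ^ (a - 1) * chiSqKernel a θ x)) (Ioi 0) := by
  have h := (integral_chiSqKernel ha hθ hb.le (by norm_num : (0 : ℝ) < 1 / 2)
    (hasSum_chiSqMoment_kummer ha hθ hb.le)).1
  simpa only [zero_mul, Real.exp_zero, mul_one] using h

include hτ

theorem integrableOn_ratioIntegral (c : ℝ) :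
    IntegrableOn (fun x : ℝ =>
      x ^ b * (x ^ (a - 1) * chiSqKernel a θ x) * chiSqKernel b τ (c * x)) (Ioi 0) := by
  obtain ⟨C, hC⟩ := exists_chiSqKernel_le hb hτ
  have hcont := continuous_chiSqKernel hb hτ
  refine Integrable.mul_bdd (c := C) (integrableOn_rpow_mul_chiSqKernel ha hb hθ)
    (hcont.comp (continuous_const_mul c)).aestronglyMeasurable ?_
  refine Eventually.of_forall fun x => ?_
  rw [Real.norm_of_nonneg (chiSqKernel_nonneg hb hτ _)]
  exact hC _

/-- Dominated convergence, since the second kernel is bounded. Continuity at c = 0 gives the edge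
behaviour of the density. -/
theorem continuous_ratioIntegral : Continuous (ratioIntegral a b θ τ) := by
  obtain ⟨C, hC⟩ := exists_chiSqKernel_le hb hτ
  have hcont := continuous_chiSqKernel hb hτ
  refine continuous_of_dominated
    (bound := fun x => x ^ b * (x ^ (a - 1) * chiSqKernel a θ x) * C)
    (fun c => (integrableOn_ratioIntegral ha hb hθ hτ c).aestronglyMeasurable) (fun c => ?_)
    ((integrableOn_rpow_mul_chiSqKernel ha hb hθ).mul_const C) ?_
  · filter_upwards [ae_restrict_mem measurableSet_Ioi] with x hx
    have hx : 0 < x := hx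
    have h1 := chiSqKernel_nonneg ha hθ x
    have h2 := chiSqKernel_nonneg hb hτ (c * x)
    rw [Real.norm_of_nonneg (by positivity)]
    gcongr
    exact hC _
  · exact Eventually.of_forall fun x => by fun_prop

theorem ratioIntegral_nonneg (c : ℝ) : 0 ≤ ratioIntegral a b θ τ c := by
  refine setIntegral_nonneg measurableSet_Ioi fun x hx => ?_
  have hx : 0 < x := hx
  have h1 := chiSqKernel_nonneg ha hθ x
  have h2 := chiSqKernel_nonneg hb hτ (c * x)
  positivity

theorem ratioDensity_nonneg (r : ℝ) : 0 ≤ ratioDensity a b θ τ r := by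
  refine indicator_nonneg (fun r hr => ?_) r
  have h1 : 0 < 1 - r := by linarith [hr.2]
  have h2 := hr.1
  have h3 := ratioIntegral_nonneg ha hb hθ hτ ((1 - r) / r)
  positivity

theorem measurable_ratioDensity : Measurable (ratioDensity a b θ τ) := by
  have := (continuous_ratioIntegral ha hb hθ hτ).measurable
  refine Measurable.indicator ?_ measurableSet_Ioo
  fun_prop

theorem continuousOn_ratioDensity : ContinuousOn (ratioDensity a b θ τ) (Ioo 0 1) := by
  have hc := continuous_ratioIntegral ha hb hθ hτ
  have : ContinuousOn (fun r =>
      (1 - r) ^ (b - 1) / r ^ (b + 1) * ratioIntegral a b θ τ ((1 - r) / r)) (Ioo 0 1) := by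
    intro r hr
    have h1 : 1 - r ≠ 0 := by linarith [hr.2]
    have h2 : r ≠ 0 := hr.1.ne'
    have h3 : r ^ (b + 1) ≠ 0 := (Real.rpow_pos_of_pos hr.1 _).ne'
    refine ContinuousAt.continuousWithinAt ?_
    refine ContinuousAt.mul (ContinuousAt.div ?_ ?_ h3) ?_
    · exact ContinuousAt.rpow_const (by fun_prop) (Or.inl h1)
    · exact ContinuousAt.rpow_const (by fun_prop) (Or.inl h2)
    · exact hc.continuousAt.comp (f := fun r : ℝ => (1 - r) / r) (by fun_prop (disch := assumption))
  exact this.congr fun r hr => indicator_of_mem hr _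

theorem tendsto_ratioDensity_div :
    Tendsto (fun r => ratioDensity a b θ τ r / (1 - r) ^ (b - 1)) (𝓝[<] 1)
      (𝓝 (ratioIntegral a b θ τ 0)) := by
  have hc := continuous_ratioIntegral ha hb hθ hτ
  have h : ContinuousAt
      (fun r : ℝ => (r ^ (b + 1))⁻¹ * ratioIntegral a b θ τ ((1 - r) / r)) 1 := by
    refine ContinuousAt.mul (ContinuousAt.inv₀ ?_ (by simp)) ?_
    · exact ContinuousAt.rpow_const (by fun_prop) (Or.inl one_ne_zero)
    · exact hc.continuousAt.comp (f := fun r : ℝ => (1 - r) / r)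
        (by fun_prop (disch := norm_num))
  have h' : Tendsto (fun r : ℝ => (r ^ (b + 1))⁻¹ * ratioIntegral a b θ τ ((1 - r) / r))
      (𝓝[<] 1) (𝓝 (ratioIntegral a b θ τ 0)) := by
    simpa using h.tendsto.mono_left nhdsWithin_le_nhds
  refine h'.congr' ?_
  filter_upwards [Ioo_mem_nhdsLT (zero_lt_one (α := ℝ))] with r hr
  have h1 : (1 - r) ^ (b - 1) ≠ 0 := (Real.rpow_pos_of_pos (by linarith [hr.2]) _).ne'
  rw [ratioDensity, indicator_of_mem hr]
  field_simp

/-- Under the product law, substitute r for y at fixed x, then swap the integrals by Tonelli so that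
x is integrated out for each r. -/
theorem hasLaw_ratioDensity {Ω : Type*} [MeasurableSpace Ω] {P : Measure Ω}
    [IsProbabilityMeasure P] {Y Z : Ω → ℝ} (hY : HasLaw Y (chiSqLaw a θ) P)
    (hZ : HasLaw Z (chiSqLaw b τ) P) (hYZ : IndepFun Y Z P) :
    HasLaw (fun ω => Y ω / (Y ω + Z ω))
      (volume.withDensity fun r => ENNReal.ofReal (ratioDensity a b θ τ r)) P := by
  have hK1 := (continuous_chiSqKernel ha hθ).measurable
  have hK2 := (continuous_chiSqKernel hb hτ).measurable
  have hpair := (indepFun_iff_hasLaw_prodMk_prod hY hZ).mp hYZ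
  have : IsProbabilityMeasure (chiSqLaw a θ) := hY.isProbabilityMeasure_iff.mp inferInstance
  have : IsProbabilityMeasure (chiSqLaw b τ) := hZ.isProbabilityMeasure_iff.mp inferInstance
  have hmeas : Measurable fun z : ℝ × ℝ => z.1 / (z.1 + z.2) := by fun_prop
  have hR : AEMeasurable (fun ω => Y ω / (Y ω + Z ω)) P :=
    hmeas.comp_aemeasurable hpair.aemeasurable
  refine ⟨hR, ?_⟩
  ext s hs
  rw [Measure.map_apply_of_aemeasurable hR hs]
  have hφ : Measurable (s.indicator (1 : ℝ → ENNReal)) := measurable_one.indicator hs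
  have h1 : P ((fun ω => Y ω / (Y ω + Z ω)) ⁻¹' s) =
      ∫⁻ z, s.indicator (1 : ℝ → ENNReal) (z.1 / (z.1 + z.2))
        ∂(chiSqLaw a θ).prod (chiSqLaw b τ) := by
    have h := hpair.measure_eq (p := fun z => z.1 / (z.1 + z.2) ∈ s) (hmeas hs)
    exact h.trans (lintegral_indicator_one (hmeas hs)).symm
  rw [h1, lintegral_prod _ (by fun_prop), withDensity_apply _ hs]
  have h2 : ∀ x, ∫⁻ y, s.indicator (1 : ℝ → ENNReal) (x / (x + y)) ∂chiSqLaw b τ =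
      ∫⁻ y in Ioi (0 : ℝ), ENNReal.ofReal (y ^ (b - 1) * chiSqKernel b τ y) *
        s.indicator (1 : ℝ → ENNReal) (x / (x + y)) := by
    intro x
    unfold chiSqLaw
    rw [lintegral_withDensity_eq_lintegral_mul _ (measurable_chiSqDensity hb hτ) (by fun_prop)]
    rfl
  simp_rw [h2]
  have hm2 : Measurable fun x => ∫⁻ y in Ioi (0 : ℝ),
      ENNReal.ofReal (y ^ (b - 1) * chiSqKernel b τ y) *
        s.indicator (1 : ℝ → ENNReal) (x / (x + y)) := by
    refine Measurable.lintegral_prod_right' (f := fun z : ℝ × ℝ =>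
      ENNReal.ofReal (z.2 ^ (b - 1) * chiSqKernel b τ z.2) *
        s.indicator (1 : ℝ → ENNReal) (z.1 / (z.1 + z.2))) ?_
    fun_prop
  rw [chiSqLaw, lintegral_withDensity_eq_lintegral_mul _ (measurable_chiSqDensity ha hθ) hm2]
  have h3 : ∀ x ∈ Ioi (0 : ℝ),
      ((fun q => ENNReal.ofReal (q ^ (a - 1) * chiSqKernel a θ q)) * fun x =>
        ∫⁻ y in Ioi (0 : ℝ), ENNReal.ofReal (y ^ (b - 1) * chiSqKernel b τ y) *
          s.indicator (1 : ℝ → ENNReal) (x / (x + y))) x =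
      ∫⁻ r in Ioo (0 : ℝ) 1, ENNReal.ofReal (x ^ (a - 1) * chiSqKernel a θ x) *
        (ENNReal.ofReal (x / r ^ 2 *
        ((x * ((1 - r) / r)) ^ (b - 1) * chiSqKernel b τ ((1 - r) / r * x))) *
          s.indicator (1 : ℝ → ENNReal) r) := by
    intro x hx
    rw [Pi.mul_apply, lintegral_ratio_inner b τ hx, lintegral_const_mul _ (by fun_prop)]
  rw [setLIntegral_congr_fun measurableSet_Ioi h3, lintegral_lintegral_swap (by fun_prop)]
  have h4 : ∀ r ∈ Ioo (0 : ℝ) 1, ∫⁻ x in Ioi (0 : ℝ),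
      ENNReal.ofReal (x ^ (a - 1) * chiSqKernel a θ x) *
        (ENNReal.ofReal (x / r ^ 2 *
        ((x * ((1 - r) / r)) ^ (b - 1) * chiSqKernel b τ ((1 - r) / r * x))) *
          s.indicator (1 : ℝ → ENNReal) r) =
      s.indicator (fun r => ENNReal.ofReal (ratioDensity a b θ τ r)) r := by
    intro r hr
    have hr0 : 0 < r := hr.1
    have hr1 : 0 < 1 - r := by linarith [hr.2]
    by_cases hrs : r ∈ s
    swap
    · simp [hrs]
    have hpt : ∀ x ∈ Ioi (0 : ℝ), ENNReal.ofReal (x ^ (a - 1) * chiSqKernel a θ x) *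
        (ENNReal.ofReal (x / r ^ 2 *
        ((x * ((1 - r) / r)) ^ (b - 1) * chiSqKernel b τ ((1 - r) / r * x))) *
          s.indicator (1 : ℝ → ENNReal) r) =
        ENNReal.ofReal ((1 - r) ^ (b - 1) / r ^ (b + 1) * (x ^ b * (x ^ (a - 1) *
          chiSqKernel a θ x) * chiSqKernel b τ ((1 - r) / r * x))) := by
      intro x hx
      have hx : 0 < x := hx
      have k1 := chiSqKernel_nonneg ha hθ x
      rw [indicator_of_mem hrs, Pi.one_apply, mul_one, ← ENNReal.ofReal_mul (by positivity)]
      congr 1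
      have e1 : x ^ b = x * x ^ (b - 1) := by
        rw [← Real.rpow_one_add' hx.le (by linarith [hb])]; ring_nf
      have e2 : r ^ (b + 1) = r ^ 2 * r ^ (b - 1) := by
        rw [← Real.rpow_natCast, ← Real.rpow_add hr0]; norm_num; ring_nf
      have h5 : r ^ (b - 1) ≠ 0 := (Real.rpow_pos_of_pos hr0 _).ne'
      rw [Real.mul_rpow hx.le (by positivity), Real.div_rpow hr1.le hr0.le, e1, e2]
      field_simp
    rw [setLIntegral_congr_fun measurableSet_Ioi hpt, indicator_of_mem hrs,
      ← ofReal_integral_eq_lintegral_ofReal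
        ((integrableOn_ratioIntegral ha hb hθ hτ _).const_mul _), integral_const_mul,
      ratioDensity, indicator_of_mem hr, ratioIntegral]
    filter_upwards [ae_restrict_mem measurableSet_Ioi] with x hx
    have hx : 0 < x := hx
    have k1 := chiSqKernel_nonneg ha hθ x
    have k2 := chiSqKernel_nonneg hb hτ ((1 - r) / r * x)
    simp only [Pi.zero_apply]
    positivity
  rw [setLIntegral_congr_fun measurableSet_Ioo h4, ← lintegral_indicator measurableSet_Ioo,
    ← lintegral_indicator hs]
  congr 1
  ext r
  by_cases hr : r ∈ Ioo (0 : ℝ) 1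
  · rw [indicator_of_mem hr]
  · rw [indicator_of_notMem hr]
    have : ratioDensity a b θ τ r = 0 := indicator_of_notMem hr _
    by_cases hrs : r ∈ s <;> simp [hrs, this]

end

/-- Two densities of one law agree almost everywhere, and Lebesgue measure charges every nonempty
open set. Any continuous density can thus be replaced by the explicit one. -/
theorem IsContinuousDensityOn.eqOn {Ω : Type*} [MeasurableSpace Ω] {Y : Ω → ℝ} {P : Measure Ω}
    [IsFiniteMeasure P] {I : Set ℝ} (hI : IsOpen I) {f g : ℝ → ℝ}
    (hf : IsContinuousDensityOn Y P I f) (hg : IsContinuousDensityOn Y P I g) : EqOn f g I := by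
  have h : volume.withDensity (fun x => ENNReal.ofReal (f x)) =
      volume.withDensity (fun x => ENNReal.ofReal (g x)) := by
    rw [← hf.law.map_eq, hg.law.map_eq]
  have hae := (withDensity_eq_iff_of_sigmaFinite
    (hf.measurable.ennreal_ofReal).aemeasurable (hg.measurable.ennreal_ofReal).aemeasurable).mp h
  refine Measure.eqOn_open_of_ae_eq (μ := volume) (ae_restrict_of_ae ?_) hI
    hf.continuousOn hg.continuousOn
  filter_upwards [hae] with x hx
  exact (ENNReal.ofReal_eq_ofReal_iff (hf.nonneg x) (hg.nonneg x)).mp hx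

/-! ### Tails of densities with a power singularity -/

theorem integral_one_sub_rpow {b r : ℝ} (hb : 0 < b) (hr : r < 1) :
    IntegrableOn (fun x : ℝ => (1 - x) ^ (b - 1)) (Ioc r 1) ∧
      ∫ x in Ioc r 1, (1 - x) ^ (b - 1) = (1 - r) ^ b / b := by
  have hb' : -1 < b - 1 := by linarith
  constructor
  · have h := (intervalIntegral.intervalIntegrable_rpow' (a := 1 - r) (b := 0) hb').comp_sub_left 1
    simp only [sub_sub_cancel, sub_zero] at h
    exact (intervalIntegrable_iff_integrableOn_Ioc_of_le hr.le).mp h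
  · rw [← intervalIntegral.integral_of_le hr.le,
      intervalIntegral.integral_comp_sub_left (fun x : ℝ => x ^ (b - 1)) 1,
      integral_rpow (Or.inl hb')]
    simp [hb.ne']

theorem tendsto_integral_tail_div {f : ℝ → ℝ} {b L : ℝ} (hb : 0 < b) (hf : Measurable f)
    (h : Tendsto (fun r => f r / (1 - r) ^ (b - 1)) (𝓝[<] 1) (𝓝 L)) :
    Tendsto (fun r => (∫ x in Ioc r 1, f x) / (1 - r) ^ b) (𝓝[<] 1) (𝓝 (L / b)) := by
  rw [Metric.tendsto_nhds]
  intro e he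
  -- Integrating (1-x)^(b-1) divides by b, so this tolerance becomes e/2.
  have heb : 0 < e * b / 2 := by positivity
  have h1 := (Metric.tendsto_nhds.mp h) (e * b / 2) heb
  rw [eventually_iff, mem_nhdsLT_iff_exists_Ioo_subset] at h1
  obtain ⟨l, hl, hsub⟩ := h1
  filter_upwards [Ioo_mem_nhdsLT hl] with r hr
  have hr1 : r < 1 := hr.2
  have hp : 0 < (1 - r) ^ b := Real.rpow_pos_of_pos (by linarith) _
  obtain ⟨hi, hI⟩ := integral_one_sub_rpow hb hr1
  have hbound : ∀ᵐ x ∂volume.restrict (Ioc r 1),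
      ‖f x - L * (1 - x) ^ (b - 1)‖ ≤ e * b / 2 * (1 - x) ^ (b - 1) := by
    -- The hypothesis says nothing at x = 1, a null point that is dropped.
    rw [restrict_Ioo_eq_restrict_Ioc.symm]
    filter_upwards [ae_restrict_mem measurableSet_Ioo] with x hx
    have hx1 : 0 < (1 - x) ^ (b - 1) := Real.rpow_pos_of_pos (by linarith [hx.2]) _
    have h2 : dist (f x / (1 - x) ^ (b - 1)) L < e * b / 2 := hsub ⟨hr.1.trans hx.1, hx.2⟩
    rw [Real.dist_eq] at h2
    have e1 : f x - L * (1 - x) ^ (b - 1) = (f x / (1 - x) ^ (b - 1) - L) * (1 - x) ^ (b - 1) := by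
      field_simp
    rw [e1, Real.norm_eq_abs, abs_mul, abs_of_pos hx1]
    gcongr
  have hdi : IntegrableOn (fun x => f x - L * (1 - x) ^ (b - 1)) (Ioc r 1) :=
    Integrable.mono' (hi.const_mul _) (by fun_prop) hbound
  have hfi : IntegrableOn f (Ioc r 1) := by
    have := hdi.add (hi.const_mul L)
    refine this.congr (Eventually.of_forall fun x => ?_)
    simp
  have h3 := norm_integral_le_of_norm_le (hi.const_mul (e * b / 2)) hbound
  rw [integral_sub hfi (hi.const_mul L), integral_const_mul, integral_const_mul, hI,
    Real.norm_eq_abs] at h3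
  rw [Real.dist_eq]
  have e2 : (∫ x in Ioc r 1, f x) / (1 - r) ^ b - L / b =
      ((∫ x in Ioc r 1, f x) - L * ((1 - r) ^ b / b)) / (1 - r) ^ b := by
    field_simp
  rw [e2, abs_div, abs_of_pos hp, div_lt_iff₀ hp]
  refine h3.trans_lt ?_
  have : e * b / 2 * ((1 - r) ^ b / b) = e / 2 * (1 - r) ^ b := by field_simp
  rw [this]
  gcongr
  linarith

/-! ### Cumulants of noncentral chi-square laws -/

/-- First derivative of `log (chiSqMgf a τ t)`. -/
noncomputable def chiSqCgfDeriv (a τ t : ℝ) : ℝ := 2 * a / (1 - 2 * t) + τ / (1 - 2 * t) ^ 2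

/-- Second derivative of `log (chiSqMgf a τ t)`. -/
noncomputable def chiSqCgfDeriv2 (a τ t : ℝ) : ℝ :=
  4 * a / (1 - 2 * t) ^ 2 + 4 * τ / (1 - 2 * t) ^ 3

theorem hasDerivAt_log_chiSqMgf (a τ : ℝ) {t : ℝ} (ht : t < 1 / 2) :
    HasDerivAt (fun t => Real.log (chiSqMgf a τ t)) (chiSqCgfDeriv a τ t) t := by
  have h1 : 1 - 2 * t ≠ 0 := by linarith
  have hd : HasDerivAt (fun t : ℝ => 1 - 2 * t) (-2) t := by
    simpa using ((hasDerivAt_id t).const_mul 2).const_sub 1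
  have hn : HasDerivAt (fun t : ℝ => τ * t) τ t := by
    simpa using (hasDerivAt_id t).const_mul τ
  have h : HasDerivAt (fun t => -a * Real.log (1 - 2 * t) + τ * t / (1 - 2 * t))
      (chiSqCgfDeriv a τ t) t := by
    refine (((hd.log h1).const_mul (-a)).add (hn.div hd h1)).congr_deriv ?_
    unfold chiSqCgfDeriv
    field_simp
    ring
  refine h.congr_of_eventuallyEq ?_
  filter_upwards [Iio_mem_nhds ht] with x hx
  have hx' : 0 < 1 - 2 * x := by linarith [mem_Iio.mp hx]
  rw [chiSqMgf, Real.log_mul (by positivity) (by positivity), Real.log_rpow hx', Real.log_exp]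

theorem hasDerivAt_chiSqCgfDeriv (a τ : ℝ) {t : ℝ} (ht : t < 1 / 2) :
    HasDerivAt (chiSqCgfDeriv a τ) (chiSqCgfDeriv2 a τ t) t := by
  have h1 : 1 - 2 * t ≠ 0 := by linarith
  have hd : HasDerivAt (fun t : ℝ => 1 - 2 * t) (-2) t := by
    simpa using ((hasDerivAt_id t).const_mul 2).const_sub 1
  have hd2 : HasDerivAt (fun t : ℝ => (1 - 2 * t) ^ 2) (-(4 * (1 - 2 * t))) t := by
    refine (hd.fun_pow 2).congr_deriv ?_
    norm_num
    ring
  refine (((hasDerivAt_const t (2 * a)).div hd h1).add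
    ((hasDerivAt_const t τ).div hd2 (pow_ne_zero 2 h1))).congr_deriv ?_
  unfold chiSqCgfDeriv2
  field_simp
  ring

theorem chiSqCgfDeriv_lt {a τ t t' : ℝ} (ha : 0 < a) (hτ : 0 ≤ τ) (htt : t < t')
    (ht : t' < 1 / 2) : chiSqCgfDeriv a τ t < chiSqCgfDeriv a τ t' := by
  have h1 : 0 < 1 - 2 * t' := by linarith
  have h2 : 1 - 2 * t' < 1 - 2 * t := by linarith
  unfold chiSqCgfDeriv
  refine add_lt_add_of_lt_of_le ?_ ?_
  · gcongr
  · gcongr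

/-! ### The saddlepoint equation -/

/-- Derivative of the cumulant generating function of `(1 - r) Y - r Z` for independent noncentral
chi-square variables `Y`, `Z`. -/
noncomputable def saddleSlope (a θ b τ r s : ℝ) : ℝ :=
  (1 - r) * chiSqCgfDeriv a θ ((1 - r) * s) - r * chiSqCgfDeriv b τ (-(r * s))

/-- Exchanging Y and Z replaces X_r by its negative; a point of negative slope then comes from
`exists_saddleSlope_pos`. -/
theorem saddleSlope_swap (a θ b τ r s : ℝ) :
    saddleSlope a θ b τ r s = -saddleSlope b τ a θ (1 - r) (-s) := by
  unfold saddleSlope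
  ring_nf

theorem saddleSlope_lt {a θ b τ r s s' : ℝ} (ha : 0 < a) (hb : 0 < b) (hθ : 0 ≤ θ) (hτ : 0 ≤ τ)
    (hr : r ∈ Ioo (0 : ℝ) 1) (hss : s < s') (hs' : (1 - r) * s' < 1 / 2)
    (hs : -(r * s) < 1 / 2) : saddleSlope a θ b τ r s < saddleSlope a θ b τ r s' := by
  have h0 := hr.1
  have h1 : 0 < 1 - r := by linarith [hr.2]
  have e1 := chiSqCgfDeriv_lt ha hθ (mul_lt_mul_of_pos_left hss h1) hs'
  have e2 := chiSqCgfDeriv_lt hb hτ (neg_lt_neg (mul_lt_mul_of_pos_left hss h0)) hs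
  have e3 := mul_lt_mul_of_pos_left e1 h1
  have e4 := mul_lt_mul_of_pos_left e2 h0
  unfold saddleSlope
  linarith

theorem exists_saddleSlope_pos {a θ b τ r : ℝ} (ha : 0 < a) (hb : 0 < b) (hθ : 0 ≤ θ) (hτ : 0 ≤ τ)
    (hr : r ∈ Ioo (0 : ℝ) 1) :
    ∃ s, 0 < s ∧ (1 - r) * s < 1 / 2 ∧ 0 < saddleSlope a θ b τ r s := by
  have h0 := hr.1
  have h1 : 0 < 1 - r := by linarith [hr.2]
  -- Here d plays the role of 1-2(1-r)s. It is chosen so that (1-r)·2a/d exceeds r(2b+τ), which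
  -- bounds the subtracted term for s > 0.
  set d : ℝ := (1 - r) * (2 * a) / ((1 - r) * (2 * a) + r * (2 * b + τ)) with hd
  have hd0 : 0 < d := by positivity
  have hd1 : d < 1 := by
    rw [hd, div_lt_one (by positivity)]
    have : 0 < r * (2 * b + τ) := by positivity
    linarith
  have hs0 : 0 < (1 - d) / (2 * (1 - r)) := div_pos (by linarith) (by linarith)
  have e : (1 - r) * ((1 - d) / (2 * (1 - r))) = (1 - d) / 2 := by field_simp
  refine ⟨(1 - d) / (2 * (1 - r)), hs0, by rw [e]; linarith, ?_⟩
  unfold saddleSlope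
  rw [e]
  have k1 : 2 * a / d ≤ chiSqCgfDeriv a θ ((1 - d) / 2) := by
    unfold chiSqCgfDeriv
    rw [show 1 - 2 * ((1 - d) / 2) = d by ring]
    have : 0 ≤ θ / d ^ 2 := by positivity
    linarith
  have k2 : chiSqCgfDeriv b τ (-(r * ((1 - d) / (2 * (1 - r))))) < chiSqCgfDeriv b τ 0 :=
    chiSqCgfDeriv_lt hb hτ (by have := mul_pos h0 hs0; linarith) (by norm_num)
  have k3 : chiSqCgfDeriv b τ 0 = 2 * b + τ := by simp [chiSqCgfDeriv]
  have k4 : (1 - r) * (2 * a / d) = (1 - r) * (2 * a) + r * (2 * b + τ) := by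
    rw [hd]; field_simp
  have k5 := mul_le_mul_of_nonneg_left k1 h1.le
  have k6 := mul_lt_mul_of_pos_left k2 h0
  rw [k3] at k6
  have k7 : 0 < (1 - r) * (2 * a) := by positivity
  linarith

theorem continuousAt_chiSqCgfDeriv (a τ : ℝ) {t : ℝ} (ht : t < 1 / 2) :
    ContinuousAt (chiSqCgfDeriv a τ) t := (hasDerivAt_chiSqCgfDeriv a τ ht).continuousAt

theorem existsUnique_saddleSlope {a θ b τ r : ℝ} (ha : 0 < a) (hb : 0 < b) (hθ : 0 ≤ θ)
    (hτ : 0 ≤ τ) (hr : r ∈ Ioo (0 : ℝ) 1) :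
    ∃! s, ((1 - r) * s < 1 / 2 ∧ -(r * s) < 1 / 2) ∧ saddleSlope a θ b τ r s = 0 := by
  have h0 := hr.1
  have h1 : 0 < 1 - r := by linarith [hr.2]
  obtain ⟨s₁, hs₁, hs₁', hp₁⟩ := exists_saddleSlope_pos ha hb hθ hτ hr
  obtain ⟨s₂, hs₂, hs₂', hp₂⟩ := exists_saddleSlope_pos hb ha hτ hθ
    (r := 1 - r) ⟨h1, by linarith⟩
  rw [sub_sub_cancel] at hs₂'
  have hp₂' : saddleSlope a θ b τ r (-s₂) < 0 := by
    rw [saddleSlope_swap, neg_neg]; linarith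
  have hdom : ∀ s ∈ Icc (-s₂) s₁, (1 - r) * s < 1 / 2 ∧ -(r * s) < 1 / 2 := by
    intro s hs
    have e1 := mul_le_mul_of_nonneg_left hs.2 h1.le
    have e2 := mul_le_mul_of_nonneg_left hs.1 h0.le
    constructor <;> linarith
  have hcont : ContinuousOn (saddleSlope a θ b τ r) (Icc (-s₂) s₁) := by
    intro s hs
    obtain ⟨e1, e2⟩ := hdom s hs
    refine ContinuousAt.continuousWithinAt ?_
    unfold saddleSlope
    refine (continuousAt_const.mul ?_).sub (continuousAt_const.mul ?_)
    · exact (continuousAt_chiSqCgfDeriv a θ e1).comp (f := fun s => (1 - r) * s) (by fun_prop)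
    · exact (continuousAt_chiSqCgfDeriv b τ e2).comp (f := fun s => -(r * s)) (by fun_prop)
  obtain ⟨s, hs, hs0⟩ := intermediate_value_Icc (by linarith) hcont
    (show (0 : ℝ) ∈ _ from ⟨hp₂'.le, hp₁.le⟩)
  refine ⟨s, ⟨hdom s hs, hs0⟩, ?_⟩
  rintro s' ⟨⟨h2, h3⟩, h4⟩
  obtain ⟨h5, h6⟩ := hdom s hs
  rcases lt_trichotomy s' s with h | h | h
  · have := saddleSlope_lt ha hb hθ hτ hr h h5 h3
    linarith
  · exact h
  · have := saddleSlope_lt ha hb hθ hτ hr h h2 h6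
    linarith

/-! ### Asymptotics at the right edge -/

/-- With t = (1-r)s fixed, the Z-denominator is (1-r+2rt)/(1-r). The central part of Z contributes
b/t, while the τ-term keeps an extra factor 1-r and vanishes. -/
theorem tendsto_saddleSlope_div {a θ b τ t : ℝ} (ht : t ∈ Ioo (0 : ℝ) (1 / 2)) :
    Tendsto (fun r => saddleSlope a θ b τ r (t / (1 - r)) / (1 - r)) (𝓝[<] 1)
      (𝓝 (chiSqCgfDeriv a θ t - b / t)) := by
  have ht0 : t ≠ 0 := ht.1.ne'
  have h : ContinuousAt (fun r : ℝ => chiSqCgfDeriv a θ t - r * (2 * b / (1 - r + 2 * r * t) +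
      τ * (1 - r) / (1 - r + 2 * r * t) ^ 2)) 1 := by
    have h1 : (1 : ℝ) - 1 + 2 * 1 * t ≠ 0 := by simpa using ht0
    have h2 : ((1 : ℝ) - 1 + 2 * 1 * t) ^ 2 ≠ 0 := pow_ne_zero 2 h1
    fun_prop (disch := assumption)
  have hlim := h.tendsto.mono_left (nhdsWithin_le_nhds (s := Iio 1))
  have e : chiSqCgfDeriv a θ t - 1 * (2 * b / (1 - 1 + 2 * 1 * t) +
      τ * (1 - 1) / (1 - 1 + 2 * 1 * t) ^ 2) = chiSqCgfDeriv a θ t - b / t := by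
    field_simp
    ring
  rw [e] at hlim
  refine hlim.congr' ?_
  filter_upwards [Ioo_mem_nhdsLT (zero_lt_one (α := ℝ))] with r hr
  have h0 := hr.1
  have h1 : 0 < 1 - r := by linarith [hr.2]
  have h3 := ht.1
  have h2 : 1 - r + 2 * r * t ≠ 0 := by positivity
  unfold saddleSlope
  rw [mul_div_cancel₀ _ h1.ne']
  have e2 : chiSqCgfDeriv b τ (-(r * (t / (1 - r)))) =
      (1 - r) * (2 * b / (1 - r + 2 * r * t) + τ * (1 - r) / (1 - r + 2 * r * t) ^ 2) := by
    have e3 : 1 - 2 * -(r * (t / (1 - r))) = (1 - r + 2 * r * t) / (1 - r) := by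
      field_simp
      ring
    unfold chiSqCgfDeriv
    rw [e3]
    field_simp
  rw [e2]
  field_simp

/-- The limiting slope increases strictly in t and vanishes at t₀. At any fixed t ≠ t₀ the slope at
t/(1-r) eventually has the limiting sign, so monotonicity in s places the root on the t₀ side of t.
-/
theorem tendsto_scaled_saddlepoint {a θ b τ t₀ : ℝ} (ha : 0 < a) (hb : 0 < b) (hθ : 0 ≤ θ)
    (hτ : 0 ≤ τ) (ht₀ : t₀ ∈ Ioo (0 : ℝ) (1 / 2)) (heq : chiSqCgfDeriv a θ t₀ = b / t₀)
    {s : ℝ → ℝ} (hs : ∀ r ∈ Ioo (0 : ℝ) 1, ((1 - r) * s r < 1 / 2 ∧ -(r * s r) < 1 / 2) ∧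
      saddleSlope a θ b τ r (s r) = 0) :
    Tendsto (fun r => (1 - r) * s r) (𝓝[<] 1) (𝓝 t₀) := by
  have hmono : ∀ t t' : ℝ, 0 < t → t < t' → t' < 1 / 2 →
      chiSqCgfDeriv a θ t - b / t < chiSqCgfDeriv a θ t' - b / t' := by
    intro t t' h1 h2 h3
    have k1 := chiSqCgfDeriv_lt ha hθ h2 h3
    have k2 : b / t' < b / t := by gcongr
    linarith
  rw [tendsto_order]
  constructor
  · intro c hc
    -- The maximum with 0 keeps t positive even when c is negative.
    obtain ⟨t, ht1, ht2⟩ := exists_between (max_lt hc ht₀.1)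
    have htpos : 0 < t := (le_max_right _ _).trans_lt ht1
    have hneg : chiSqCgfDeriv a θ t - b / t < 0 := by
      have := hmono t t₀ htpos ht2 ht₀.2
      linarith
    filter_upwards [Ioo_mem_nhdsLT (zero_lt_one (α := ℝ)),
      (tendsto_saddleSlope_div (τ := τ) ⟨htpos, ht2.trans ht₀.2⟩).eventually_lt_const hneg]
      with r hr hlt
    have h0 := hr.1
    have h1 : 0 < 1 - r := by linarith [hr.2]
    obtain ⟨⟨k1, k2⟩, k3⟩ := hs r hr
    refine ((le_max_left _ _).trans_lt ht1).trans ?_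
    by_contra hcon
    push Not at hcon
    have hle : s r ≤ t / (1 - r) := by rw [le_div_iff₀ h1]; linarith
    have hsl : saddleSlope a θ b τ r (t / (1 - r)) < 0 := by
      have := (div_lt_iff₀ h1).mp hlt
      linarith
    rcases hle.eq_or_lt with h | h
    · rw [← h, k3] at hsl; exact lt_irrefl _ hsl
    · have := saddleSlope_lt ha hb hθ hτ hr h
        (by rw [mul_div_cancel₀ _ h1.ne']; exact ht2.trans ht₀.2) k2
      linarith
  · intro c hc
    obtain ⟨t, ht1, ht2⟩ := exists_between (lt_min hc ht₀.2)
    have htpos : 0 < t := ht₀.1.trans ht1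
    have hthalf : t < 1 / 2 := ht2.trans_le (min_le_right _ _)
    have hpos : 0 < chiSqCgfDeriv a θ t - b / t := by
      have := hmono t₀ t ht₀.1 ht1 hthalf
      linarith
    filter_upwards [Ioo_mem_nhdsLT (zero_lt_one (α := ℝ)),
      (tendsto_saddleSlope_div (τ := τ) ⟨htpos, hthalf⟩).eventually_const_lt hpos]
      with r hr hlt
    have h0 := hr.1
    have h1 : 0 < 1 - r := by linarith [hr.2]
    obtain ⟨⟨k1, k2⟩, k3⟩ := hs r hr
    refine lt_trans ?_ (ht2.trans_le (min_le_left _ _))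
    by_contra hcon
    push Not at hcon
    have hle : t / (1 - r) ≤ s r := by rw [div_le_iff₀ h1]; linarith
    have hsl : 0 < saddleSlope a θ b τ r (t / (1 - r)) := by
      have := (lt_div_iff₀ h1).mp hlt
      linarith
    rcases hle.eq_or_lt with h | h
    · rw [h, k3] at hsl; exact lt_irrefl _ hsl
    · have hn : 0 < r * (t / (1 - r)) := by positivity
      have := saddleSlope_lt ha hb hθ hτ hr h k1 (by linarith)
      linarith

/-- Moment generating function of `(1 - r) Y - r Z` for independent noncentral chi-square
variables. -/
noncomputable def saddleMgf (a θ b τ r s : ℝ) : ℝ :=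
  chiSqMgf a θ ((1 - r) * s) * chiSqMgf b τ (-(r * s))

/-- Second derivative of `log (saddleMgf a θ b τ r s)`. -/
noncomputable def saddleCurv (a θ b τ r s : ℝ) : ℝ :=
  (1 - r) ^ 2 * chiSqCgfDeriv2 a θ ((1 - r) * s) + r ^ 2 * chiSqCgfDeriv2 b τ (-(r * s))

/-- The base 1+2rs in the Z-factor equals (1-r+2r(1-r)s)/(1-r), which releases (1-r)^b. The rest is
continuous in the pair (r, (1-r)s) at (1, t₀). -/
theorem tendsto_saddleMgf_div {a θ b τ t₀ : ℝ}
    (ht₀ : t₀ ∈ Ioo (0 : ℝ) (1 / 2)) {s : ℝ → ℝ}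
    (hs : Tendsto (fun r => (1 - r) * s r) (𝓝[<] 1) (𝓝 t₀)) :
    Tendsto (fun r => saddleMgf a θ b τ r (s r) / (1 - r) ^ b) (𝓝[<] 1)
      (𝓝 (chiSqMgf a θ t₀ * ((2 * t₀) ^ (-b) * Real.exp (-(τ / 2))))) := by
  have h0 := ht₀.1
  have hy : 0 < 1 - 2 * t₀ := by linarith [ht₀.2]
  have hpair : Tendsto (fun r : ℝ => (r, (1 - r) * s r)) (𝓝[<] 1) (𝓝 (1, t₀)) :=
    (tendsto_id.mono_left nhdsWithin_le_nhds).prodMk_nhds hs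
  have h : ContinuousAt (fun p : ℝ × ℝ => chiSqMgf a θ p.2 *
      ((1 - p.1 + 2 * p.1 * p.2) ^ (-b) *
        Real.exp (-(τ * (p.1 * p.2)) / (1 - p.1 + 2 * p.1 * p.2)))) (1, t₀) := by
    have h1 : (1 : ℝ) - 1 + 2 * 1 * t₀ ≠ 0 := by simpa using h0.ne'
    have h2 : 1 - 2 * t₀ ≠ 0 := hy.ne'
    unfold chiSqMgf
    refine ContinuousAt.mul (ContinuousAt.mul ?_ ?_) (ContinuousAt.mul ?_ ?_)
    · exact ContinuousAt.rpow_const (by fun_prop) (Or.inl h2)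
    · fun_prop (disch := assumption)
    · exact ContinuousAt.rpow_const (by fun_prop) (Or.inl h1)
    · fun_prop (disch := assumption)
  have hlim := h.tendsto.comp hpair
  have e : -(τ * (1 * t₀)) / (1 - 1 + 2 * 1 * t₀) = -(τ / 2) := by
    field_simp
    ring
  simp only [e] at hlim
  rw [show (1 : ℝ) - 1 + 2 * 1 * t₀ = 2 * t₀ by ring] at hlim
  refine hlim.congr' ?_
  filter_upwards [Ioo_mem_nhdsLT (zero_lt_one (α := ℝ)), hs.eventually_const_lt h0] with r hr hpos
  have hr0 := hr.1
  have h1 : 0 < 1 - r := by linarith [hr.2]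
  have hsr : 0 < s r := pos_of_mul_pos_right hpos h1.le
  have e3 : 1 - 2 * -(r * s r) = (1 - r + 2 * r * ((1 - r) * s r)) / (1 - r) := by
    field_simp
    ring
  have h2 : 0 < 1 - r + 2 * r * ((1 - r) * s r) := by positivity
  have h4 : (1 - r) ^ b ≠ 0 := (Real.rpow_pos_of_pos h1 _).ne'
  simp only [Function.comp_apply, saddleMgf]
  have e4 : chiSqMgf b τ (-(r * s r)) = (1 - r) ^ b * ((1 - r + 2 * r * ((1 - r) * s r)) ^ (-b) *
      Real.exp (-(τ * (r * ((1 - r) * s r))) / (1 - r + 2 * r * ((1 - r) * s r)))) := by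
    rw [chiSqMgf, e3, Real.div_rpow h2.le h1.le, Real.rpow_neg h1.le b, div_inv_eq_mul]
    have : τ * -(r * s r) / ((1 - r + 2 * r * ((1 - r) * s r)) / (1 - r)) =
        -(τ * (r * ((1 - r) * s r))) / (1 - r + 2 * r * ((1 - r) * s r)) := by
      field_simp
    rw [this]
    ring
  rw [e4]
  field_simp

/-- Multiplying by s² absorbs the blow-up of the saddlepoint: the Y-part depends only on (1-r)s, and
the Z-part tends to t₀²·4b/(2t₀)² = b. -/
theorem tendsto_saddleCurv {a θ b τ t₀ : ℝ}
    (ht₀ : t₀ ∈ Ioo (0 : ℝ) (1 / 2)) {s : ℝ → ℝ}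
    (hs : Tendsto (fun r => (1 - r) * s r) (𝓝[<] 1) (𝓝 t₀)) :
    Tendsto (fun r => s r ^ 2 * saddleCurv a θ b τ r (s r)) (𝓝[<] 1)
      (𝓝 (t₀ ^ 2 * chiSqCgfDeriv2 a θ t₀ + b)) := by
  have h0 := ht₀.1
  have hy : 0 < 1 - 2 * t₀ := by linarith [ht₀.2]
  have hpair : Tendsto (fun r : ℝ => (r, (1 - r) * s r)) (𝓝[<] 1) (𝓝 (1, t₀)) :=
    (tendsto_id.mono_left nhdsWithin_le_nhds).prodMk_nhds hs
  have h : ContinuousAt (fun p : ℝ × ℝ => p.2 ^ 2 * chiSqCgfDeriv2 a θ p.2 +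
      p.1 ^ 2 * p.2 ^ 2 * (4 * b / (1 - p.1 + 2 * p.1 * p.2) ^ 2 +
        4 * τ * (1 - p.1) / (1 - p.1 + 2 * p.1 * p.2) ^ 3)) (1, t₀) := by
    have h1 : (1 : ℝ) - 1 + 2 * 1 * t₀ ≠ 0 := by simpa using h0.ne'
    have h2 : 1 - 2 * t₀ ≠ 0 := hy.ne'
    have h3 := pow_ne_zero 2 h1
    have h4 := pow_ne_zero 3 h1
    have h5 := pow_ne_zero 2 h2
    have h6 := pow_ne_zero 3 h2
    unfold chiSqCgfDeriv2
    fun_prop (disch := assumption)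
  have hlim := h.tendsto.comp hpair
  have e : t₀ ^ 2 * chiSqCgfDeriv2 a θ t₀ +
      1 ^ 2 * t₀ ^ 2 * (4 * b / (1 - 1 + 2 * 1 * t₀) ^ 2 +
        4 * τ * (1 - 1) / (1 - 1 + 2 * 1 * t₀) ^ 3) = t₀ ^ 2 * chiSqCgfDeriv2 a θ t₀ + b := by
    field_simp
    ring
  simp only [e] at hlim
  refine hlim.congr' ?_
  filter_upwards [Ioo_mem_nhdsLT (zero_lt_one (α := ℝ)), hs.eventually_const_lt h0] with r hr hpos
  have hr0 := hr.1
  have h1 : 0 < 1 - r := by linarith [hr.2]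
  have hsr : 0 < s r := pos_of_mul_pos_right hpos h1.le
  have e3 : 1 - 2 * -(r * s r) = (1 - r + 2 * r * ((1 - r) * s r)) / (1 - r) := by
    field_simp
    ring
  have h2 : 0 < 1 - r + 2 * r * ((1 - r) * s r) := by positivity
  simp only [Function.comp_apply, saddleCurv]
  have e4 : chiSqCgfDeriv2 b τ (-(r * s r)) = (1 - r) ^ 2 *
      (4 * b / (1 - r + 2 * r * ((1 - r) * s r)) ^ 2 +
        4 * τ * (1 - r) / (1 - r + 2 * r * ((1 - r) * s r)) ^ 3) := by
    rw [chiSqCgfDeriv2, e3]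
    field_simp
  rw [e4]
  ring

/-! ### The Lugannani–Rice tail for large `w` -/

/-- Mills bound: wφ(x) ≤ xφ(x) for x > w, and -φ is an antiderivative of xφ(x). -/
theorem one_sub_cdf_gaussian_le {w : ℝ} (hw : 0 < w) :
    1 - cdf (gaussianReal 0 1) w ≤ gaussianPDFReal 0 1 w / w := by
  have hpdf : ∀ x, gaussianPDFReal 0 1 x = (√(2 * Real.pi))⁻¹ * Real.exp (-(x ^ 2 / 2)) := by
    intro x
    simp [gaussianPDFReal, neg_div]
  have hderiv : ∀ x ∈ Ici w, HasDerivAt (fun x => -gaussianPDFReal 0 1 x)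
      (x * gaussianPDFReal 0 1 x) x := by
    intro x _
    have h1 : HasDerivAt (fun x : ℝ => -(x ^ 2 / 2)) (-x) x := by
      refine (((hasDerivAt_pow 2 x).div_const 2).neg).congr_deriv ?_
      simp
    have := ((h1.exp).const_mul (√(2 * Real.pi))⁻¹).neg
    simp only [hpdf]
    refine this.congr_deriv ?_
    ring
  have hlim : Tendsto (fun x => -gaussianPDFReal 0 1 x) atTop (𝓝 0) := by
    have h1 : Tendsto (fun x : ℝ => x ^ 2 / 2) atTop atTop :=
      (tendsto_pow_atTop two_ne_zero).atTop_div_const two_pos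
    have h2 := ((Real.tendsto_exp_neg_atTop_nhds_zero.comp h1).const_mul
      (√(2 * Real.pi))⁻¹).neg
    simp only [mul_zero, neg_zero] at h2
    simp only [hpdf]
    exact h2
  have hnn : ∀ x ∈ Ioi w, 0 ≤ x * gaussianPDFReal 0 1 x := fun x hx =>
    mul_nonneg (hw.trans hx).le (gaussianPDFReal_nonneg 0 1 x)
  have hint := integrableOn_Ioi_deriv_of_nonneg' hderiv hnn hlim
  have hval := integral_Ioi_of_hasDerivAt_of_nonneg' hderiv hnn hlim
  have h1 : 1 - cdf (gaussianReal 0 1) w = (gaussianReal 0 1).real (Ioi w) := by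
    rw [cdf_eq_real, ← compl_Iic, probReal_compl_eq_one_sub measurableSet_Iic]
  have h2 : (gaussianReal 0 1).real (Ioi w) = ∫ x in Ioi w, gaussianPDFReal 0 1 x := by
    rw [measureReal_def, gaussianReal_apply_eq_integral 0 one_ne_zero, ENNReal.toReal_ofReal]
    exact setIntegral_nonneg measurableSet_Ioi fun x _ => gaussianPDFReal_nonneg 0 1 x
  rw [h1, h2, le_div_iff₀ hw, mul_comm, ← integral_const_mul]
  rw [zero_sub, neg_neg] at hval
  rw [← hval]
  refine setIntegral_mono_on ((integrable_gaussianPDFReal 0 1).integrableOn.const_mul w) hint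
    measurableSet_Ioi fun x hx => ?_
  have := gaussianPDFReal_nonneg 0 1 x
  gcongr
  exact (mem_Ioi.mp hx).le

/-- The quotient is (1-Φ(w))/φ(w) - 1/w + 1/u, whose first two terms vanish. -/
theorem tendsto_lugannaniRice_tail {ι : Type*} {l : Filter ι} {w u : ι → ℝ} {u₀ : ℝ} (hu₀ : u₀ ≠ 0)
    (hw : Tendsto w l atTop) (hu : Tendsto u l (𝓝 u₀)) :
    Tendsto (fun i => (1 - (cdf (gaussianReal 0 1) (w i) +
      gaussianPDFReal 0 1 (w i) * ((w i)⁻¹ - (u i)⁻¹))) / gaussianPDFReal 0 1 (w i)) l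
      (𝓝 u₀⁻¹) := by
  have hinv : Tendsto (fun i => (w i)⁻¹) l (𝓝 0) := tendsto_inv_atTop_zero.comp hw
  have hmills : Tendsto (fun i => (1 - cdf (gaussianReal 0 1) (w i)) / gaussianPDFReal 0 1 (w i)) l
      (𝓝 0) := by
    refine tendsto_of_tendsto_of_tendsto_of_le_of_le' tendsto_const_nhds hinv ?_ ?_
    · exact Eventually.of_forall fun i => div_nonneg
        (by linarith [cdf_le_one (gaussianReal 0 1) (w i)])
        (gaussianPDFReal_nonneg _ _ _)
    · filter_upwards [hw.eventually_gt_atTop 0] with i hi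
      rw [div_le_iff₀ (gaussianPDFReal_pos _ _ _ one_ne_zero), inv_mul_eq_div]
      exact one_sub_cdf_gaussian_le hi
  have h := (hmills.sub hinv).add (hu.inv₀ hu₀)
  rw [sub_zero, zero_add] at h
  refine h.congr fun i => ?_
  have := (gaussianPDFReal_pos 0 1 (w i) one_ne_zero).ne'
  field_simp
  ring

/-! ### The beta case -/

/-- The coordinates selected by `betaA n m`. -/
def headCoords (n m : ℕ) : Finset (Fin n) := Finset.univ.filter fun i => i.val < m

/-- The coordinates killed by `betaA n m`. -/
def tailCoords (n m : ℕ) : Finset (Fin n) := Finset.univ.filter fun i => ¬ i.val < m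

theorem card_headCoords {n m : ℕ} (h : m ≤ n) : (headCoords n m).card = m := by
  rw [headCoords, Fin.card_filter_val_lt, min_eq_right h]

theorem card_tailCoords {n m : ℕ} (h : m ≤ n) : (tailCoords n m).card = n - m := by
  have h1 := Finset.card_filter_add_card_filter_not (s := (Finset.univ : Finset (Fin n)))
    (fun i => i.val < m)
  have h2 := card_headCoords h
  rw [Finset.card_univ, Fintype.card_fin] at h1
  unfold headCoords at h2
  unfold tailCoords
  omega

theorem disjoint_coords (n m : ℕ) : Disjoint (headCoords n m) (tailCoords n m) :=
  Finset.disjoint_filter_filter_not _ _ _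

theorem sum_coords {n : ℕ} (m : ℕ) (f : Fin n → ℝ) (x y : ℝ) :
    ∑ i, (if i.val < m then x else y) * f i =
      x * ∑ i ∈ headCoords n m, f i + y * ∑ i ∈ tailCoords n m, f i := by
  rw [← Finset.sum_filter_add_sum_filter_not Finset.univ (fun i : Fin n => i.val < m),
    Finset.mul_sum, Finset.mul_sum]
  congr 1
  · exact Finset.sum_congr rfl fun i hi => by rw [if_pos (Finset.mem_filter.mp hi).2]
  · exact Finset.sum_congr rfl fun i hi => by rw [if_neg (Finset.mem_filter.mp hi).2]

/-- Sum of the squared means of the coordinates killed by `betaA n m`. -/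
def thetaTail {n : ℕ} (m : ℕ) (μ : Fin n → ℝ) : ℝ := ∑ i ∈ tailCoords n m, μ i ^ 2

theorem theta_nonneg {n : ℕ} (m : ℕ) (μ : Fin n → ℝ) : 0 ≤ theta m μ :=
  Finset.sum_nonneg fun _ _ => sq_nonneg _

theorem thetaTail_nonneg {n : ℕ} (m : ℕ) (μ : Fin n → ℝ) : 0 ≤ thetaTail m μ :=
  Finset.sum_nonneg fun _ _ => sq_nonneg _

theorem betaA_sub_smul (n m : ℕ) (r : ℝ) :
    betaA n m - r • 1 = diagonal fun i => if i.val < m then 1 - r else -r := by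
  rw [betaA, smul_one_eq_diagonal, diagonal_sub]
  congr 1
  ext i
  split_ifs <;> ring

theorem quadForm_diagonal {n : ℕ} {Ω : Type*} (d : Fin n → ℝ) (ε : Fin n → Ω → ℝ) (ω : Ω) :
    quadForm (diagonal d) ε ω = ∑ i, d i * ε i ω ^ 2 := by
  simp only [quadForm, dotProduct, mulVec_diagonal]
  exact Finset.sum_congr rfl fun i _ => by ring

theorem formX_beta {n : ℕ} {Ω : Type*} (m : ℕ) (ε : Fin n → Ω → ℝ) (r : ℝ) (ω : Ω) :
    formX (betaA n m) 1 ε r ω =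
      (1 - r) * sqSum ε (headCoords n m) ω + -r * sqSum ε (tailCoords n m) ω := by
  rw [formX, betaA_sub_smul, quadForm_diagonal, sum_coords]
  rfl

theorem ratio_beta {n : ℕ} {Ω : Type*} (m : ℕ) (ε : Fin n → Ω → ℝ) (ω : Ω) :
    ratio (betaA n m) 1 ε ω = sqSum ε (headCoords n m) ω /
      (sqSum ε (headCoords n m) ω + sqSum ε (tailCoords n m) ω) := by
  have h1 : (1 : Matrix (Fin n) (Fin n) ℝ) = diagonal fun i => if i.val < m then 1 else 1 := by
    simp
  rw [ratio, h1, betaA, quadForm_diagonal, quadForm_diagonal, sum_coords, sum_coords]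
  simp [sqSum]

theorem mem_strip_beta {n m : ℕ} (hm : 1 ≤ m) (hmn : m < n) {r s : ℝ} (hr : r ∈ Ioo (0 : ℝ) 1) :
    s ∈ strip (betaA n m) 1 r ↔ (1 - r) * s < 1 / 2 ∧ -(r * s) < 1 / 2 := by
  have h0 := hr.1
  have h1 : 0 < 1 - r := by linarith [hr.2]
  have hsp : spectrum ℝ (betaA n m - r • 1) = {-r, 1 - r} := by
    rw [betaA_sub_smul, spectrum_diagonal]
    ext x
    constructor
    · rintro ⟨i, rfl⟩
      simp only
      split_ifs <;> simp
    · rintro (rfl | rfl)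
      -- Index m lies in the tail block and index 0 in the head block, so both eigenvalues occur.
      · exact ⟨⟨m, hmn⟩, by simp⟩
      · exact ⟨⟨0, by omega⟩, by simp; omega⟩
  rw [strip, hsp, csInf_pair, csSup_pair, min_eq_left (by linarith), max_eq_right (by linarith),
    mem_Ioo, lt_div_iff₀ (by linarith), show 1 / (2 * -r) = -(1 / (2 * r)) by ring, neg_lt,
    lt_div_iff₀ (by linarith)]
  constructor <;> rintro ⟨h2, h3⟩ <;> constructor <;> linarith

theorem isOpen_strip {n : ℕ} (A B : Matrix (Fin n) (Fin n) ℝ) (r : ℝ) : IsOpen (strip A B r) :=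
  isOpen_Ioo

/-- With B the identity all matrices are diagonal. J_r is the plain sum of the cumulant slopes of Y
and Z, whereas K' weights them by 1-r and -r. -/
theorem saddleFactor_beta {n m : ℕ} (hmn : m ≤ n) (μ : Fin n → ℝ) {r s : ℝ}
    (h1 : (1 - r) * s < 1 / 2) (h2 : -(r * s) < 1 / 2) :
    saddleFactor (betaA n m) 1 μ r s = chiSqCgfDeriv (m / 2) (theta m μ) ((1 - r) * s) +
      chiSqCgfDeriv (((n : ℝ) - m) / 2) (thetaTail m μ) (-(r * s)) := by
  set x : ℝ := 1 - 2 * ((1 - r) * s) with hx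
  set y : ℝ := 1 - 2 * -(r * s) with hy
  have hx0 : x ≠ 0 := by rw [hx]; linarith
  have hy0 : y ≠ 0 := by rw [hy]; linarith
  have hD : (1 - (2 * s) • (betaA n m - r • 1) : Matrix (Fin n) (Fin n) ℝ) =
      diagonal fun i => if i.val < m then x else y := by
    rw [betaA_sub_smul, ← diagonal_one, ← diagonal_smul, diagonal_sub]
    congr 1
    ext i
    simp only [Pi.smul_apply, smul_eq_mul]
    split_ifs
    · rw [hx]; ring
    · rw [hy]; ring
  have hinv : (diagonal fun i : Fin n => if i.val < m then x else y)⁻¹ =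
      diagonal fun i : Fin n => if i.val < m then x⁻¹ else y⁻¹ := by
    refine inv_eq_right_inv ?_
    rw [diagonal_mul_diagonal, ← diagonal_one]
    congr 1
    ext i
    split_ifs
    · exact mul_inv_cancel₀ hx0
    · exact mul_inv_cancel₀ hy0
  have htr := sum_coords m (fun _ : Fin n => (1 : ℝ)) x⁻¹ y⁻¹
  have hq := sum_coords m (fun i : Fin n => μ i ^ 2) (x⁻¹ ^ 2) (y⁻¹ ^ 2)
  simp only [mul_one, Finset.sum_const, nsmul_eq_mul] at htr
  rw [card_headCoords hmn, card_tailCoords hmn, Nat.cast_sub hmn] at htr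
  unfold saddleFactor
  rw [hD, hinv, mul_one, trace_diagonal, htr, diagonal_mul_diagonal]
  have hdot : μ ⬝ᵥ (diagonal (fun i : Fin n => (if i.val < m then x⁻¹ else y⁻¹) *
      if i.val < m then x⁻¹ else y⁻¹) *ᵥ μ) =
      ∑ i : Fin n, (if i.val < m then x⁻¹ ^ 2 else y⁻¹ ^ 2) * μ i ^ 2 := by
    simp only [dotProduct, mulVec_diagonal]
    refine Finset.sum_congr rfl fun i _ => ?_
    split_ifs <;> ring
  have hth : theta m μ = ∑ i ∈ headCoords n m, μ i ^ 2 := rfl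
  rw [hdot, hq, chiSqCgfDeriv, chiSqCgfDeriv, ← hx, ← hy, hth, thetaTail]
  field_simp
  ring

theorem saddleMgf_pos (a θ b τ : ℝ) {r s : ℝ} (h1 : (1 - r) * s < 1 / 2)
    (h2 : -(r * s) < 1 / 2) : 0 < saddleMgf a θ b τ r s :=
  mul_pos (chiSqMgf_pos _ _ h1) (chiSqMgf_pos _ _ h2)

section

variable {n m : ℕ} {Ω : Type*} [MeasurableSpace Ω] {P : Measure Ω}
  {μ : Fin n → ℝ} {ε : Fin n → Ω → ℝ} (hm : 1 ≤ m) (hmn : m < n) (hε : IsGaussianVector ε μ P)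
include hm hmn hε

theorem mgf_formX_beta {r s : ℝ} (hr : r ∈ Ioo (0 : ℝ) 1) (hs : s ∈ strip (betaA n m) 1 r) :
    mgf (formX (betaA n m) 1 ε r) P s =
      saddleMgf (m / 2) (theta m μ) (((n : ℝ) - m) / 2) (thetaTail m μ) r s := by
  obtain ⟨h1, h2⟩ := (mem_strip_beta hm hmn hr).mp hs
  have hind := (hε.indepFun_sqSum (disjoint_coords n m)).comp
    (measurable_const_mul (1 - r)) (measurable_const_mul (-r))
  have hX : formX (betaA n m) 1 ε r =
      ((fun x => (1 - r) * x) ∘ sqSum ε (headCoords n m)) +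
        ((fun x => -r * x) ∘ sqSum ε (tailCoords n m)) := by
    ext ω
    exact formX_beta m ε r ω
  rw [hX, hind.mgf_add' ((hε.aemeasurable_sqSum _).const_mul _).aestronglyMeasurable
    ((hε.aemeasurable_sqSum _).const_mul _).aestronglyMeasurable]
  have e1 := hε.mgf_sqSum (headCoords n m) h1
  have e2 := hε.mgf_sqSum (tailCoords n m) h2
  rw [card_headCoords hmn.le] at e1
  rw [card_tailCoords hmn.le, Nat.cast_sub hmn.le] at e2
  have f1 : mgf ((fun x => (1 - r) * x) ∘ sqSum ε (headCoords n m)) P s =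
      mgf (sqSum ε (headCoords n m)) P ((1 - r) * s) := mgf_const_mul (1 - r)
  have f2 : mgf ((fun x => -r * x) ∘ sqSum ε (tailCoords n m)) P s =
      mgf (sqSum ε (tailCoords n m)) P (-r * s) := mgf_const_mul (-r)
  rw [f1, f2, e1, neg_mul, e2]
  rfl

theorem hasDerivAt_cumulant_beta {r s : ℝ} (hr : r ∈ Ioo (0 : ℝ) 1)
    (hs : s ∈ strip (betaA n m) 1 r) :
    HasDerivAt (cumulant (betaA n m) 1 ε P r)
      (saddleSlope (m / 2) (theta m μ) (((n : ℝ) - m) / 2) (thetaTail m μ) r s) s := by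
  obtain ⟨h1, h2⟩ := (mem_strip_beta hm hmn hr).mp hs
  have d1 : HasDerivAt (fun s : ℝ => (1 - r) * s) (1 - r) s := by
    simpa using (hasDerivAt_id s).const_mul (1 - r)
  have d2 : HasDerivAt (fun s : ℝ => -(r * s)) (-r) s := by
    simpa using ((hasDerivAt_id s).const_mul r).fun_neg
  have k1 := (hasDerivAt_log_chiSqMgf (m / 2) (theta m μ) h1).comp s d1
  have k2 := (hasDerivAt_log_chiSqMgf (((n : ℝ) - m) / 2) (thetaTail m μ) h2).comp s d2
  refine ((k1.add k2).congr_deriv ?_).congr_of_eventuallyEq ?_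
  · unfold saddleSlope; ring
  · filter_upwards [(isOpen_strip _ _ _).mem_nhds hs] with x hx
    obtain ⟨h3, h4⟩ := (mem_strip_beta hm hmn hr).mp hx
    rw [cumulant, cgf, mgf_formX_beta hm hmn hε hr hx, saddleMgf,
      Real.log_mul (chiSqMgf_pos _ _ h3).ne' (chiSqMgf_pos _ _ h4).ne']
    rfl

theorem iteratedDeriv_two_cumulant_beta {r s : ℝ} (hr : r ∈ Ioo (0 : ℝ) 1)
    (hs : s ∈ strip (betaA n m) 1 r) :
    iteratedDeriv 2 (cumulant (betaA n m) 1 ε P r) s =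
      saddleCurv (m / 2) (theta m μ) (((n : ℝ) - m) / 2) (thetaTail m μ) r s := by
  obtain ⟨h1, h2⟩ := (mem_strip_beta hm hmn hr).mp hs
  have d1 : HasDerivAt (fun s : ℝ => (1 - r) * s) (1 - r) s := by
    simpa using (hasDerivAt_id s).const_mul (1 - r)
  have d2 : HasDerivAt (fun s : ℝ => -(r * s)) (-r) s := by
    simpa using ((hasDerivAt_id s).const_mul r).fun_neg
  have k1 := ((hasDerivAt_chiSqCgfDeriv (m / 2) (theta m μ) h1).comp s d1).const_mul (1 - r)
  have k2 := ((hasDerivAt_chiSqCgfDeriv (((n : ℝ) - m) / 2) (thetaTail m μ) h2).comp s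
    d2).const_mul r
  rw [iteratedDeriv_succ, iteratedDeriv_one]
  refine HasDerivAt.deriv (((k1.sub k2).congr_deriv ?_).congr_of_eventuallyEq ?_)
  · unfold saddleCurv; ring
  · filter_upwards [(isOpen_strip _ _ _).mem_nhds hs] with x hx
    exact (hasDerivAt_cumulant_beta hm hmn hε hr hx).deriv

theorem isSaddlepoint_beta_iff {r s : ℝ} (hr : r ∈ Ioo (0 : ℝ) 1) :
    IsSaddlepoint (betaA n m) 1 ε P r s ↔ ((1 - r) * s < 1 / 2 ∧ -(r * s) < 1 / 2) ∧
      saddleSlope (m / 2) (theta m μ) (((n : ℝ) - m) / 2) (thetaTail m μ) r s = 0 := by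
  rw [← mem_strip_beta hm hmn hr]
  refine and_congr_right fun hs => ?_
  rw [(hasDerivAt_cumulant_beta hm hmn hε hr hs).deriv]

theorem existsUnique_isSaddlepoint_beta {r : ℝ} (hr : r ∈ Ioo (0 : ℝ) 1) :
    ∃! s, IsSaddlepoint (betaA n m) 1 ε P r s := by
  simp only [isSaddlepoint_beta_iff hm hmn hε hr]
  have h1 : (0 : ℝ) < m := by exact_mod_cast hm
  have h2 : (m : ℝ) < n := by exact_mod_cast hmn
  exact existsUnique_saddleSlope (by linarith) (by linarith) (theta_nonneg m μ)
    (thetaTail_nonneg m μ) hr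

theorem isSaddlepoint_saddlepoint_beta {r : ℝ} (hr : r ∈ Ioo (0 : ℝ) 1) :
    IsSaddlepoint (betaA n m) 1 ε P r (saddlepoint (betaA n m) 1 ε P r) :=
  Classical.epsilon_spec (existsUnique_isSaddlepoint_beta hm hmn hε hr).exists

/-- K'(0) = E[X_r], so a zero mean makes 0 the unique root. Contrapositively, a positive saddlepoint
selects the generic Lugannani–Rice branch. -/
theorem saddlepoint_eq_zero_of_integral_eq_zero [IsProbabilityMeasure P]
    {r : ℝ} (hr : r ∈ Ioo (0 : ℝ) 1)
    (h : ∫ ω, formX (betaA n m) 1 ε r ω ∂P = 0) : saddlepoint (betaA n m) 1 ε P r = 0 := by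
  have h0 : (0 : ℝ) ∈ strip (betaA n m) 1 r := by
    rw [mem_strip_beta hm hmn hr]; norm_num
  have hint : (0 : ℝ) ∈ interior (integrableExpSet (formX (betaA n m) 1 ε r) P) := by
    rw [mem_interior_iff_mem_nhds]
    filter_upwards [(isOpen_strip _ _ _).mem_nhds h0] with s hs
    refine mgf_pos_iff.mp ?_
    rw [mgf_formX_beta hm hmn hε hr hs]
    obtain ⟨h1, h2⟩ := (mem_strip_beta hm hmn hr).mp hs
    exact saddleMgf_pos _ _ _ _ h1 h2
  have hd : deriv (cumulant (betaA n m) 1 ε P r) 0 = 0 := by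
    rw [cumulant, deriv_cgf_zero hint, h, zero_div]
  exact (existsUnique_isSaddlepoint_beta hm hmn hε hr).unique
    (isSaddlepoint_saddlepoint_beta hm hmn hε hr) ⟨h0, hd⟩

end

/-! ### The limiting constants -/

/-- In y = 1-2t the limiting equation m/y + θ/y² = (n-m)/(1-y) becomes ny² + (θ-m)y - θ = 0, and t₀
corresponds to its positive root. -/
theorem tZero_spec {n m : ℕ} (hm : 1 ≤ m) (hmn : m < n) {θ : ℝ} (hθ : 0 ≤ θ) :
    tZero n m θ ∈ Ioo (0 : ℝ) (1 / 2) ∧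
      chiSqCgfDeriv (m / 2) θ (tZero n m θ) = ((n : ℝ) - m) / 2 / tZero n m θ := by
  have hm0 : (0 : ℝ) < m := by exact_mod_cast hm
  have hmn0 : (m : ℝ) < n := by exact_mod_cast hmn
  have hn0 : (0 : ℝ) < n := hm0.trans hmn0
  set q : ℝ := √((θ - m) ^ 2 + 4 * θ * n) with hq
  have hq2 : q ^ 2 = (θ - m) ^ 2 + 4 * θ * n := Real.sq_sqrt (by positivity)
  have hq0 : 0 ≤ q := Real.sqrt_nonneg _
  set y : ℝ := (q - (θ - m)) / (2 * n) with hy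
  have ht : tZero n m θ = (1 - y) / 2 := by
    rw [tZero, ← hq, hy]
    field_simp
    ring
  have hroot : n * y ^ 2 + (θ - m) * y - θ = 0 := by
    rw [hy]
    field_simp
    linear_combination hq2
  have hy0 : 0 < y := by
    refine div_pos ?_ (by positivity)
    by_contra hcon
    push Not at hcon
    have h1 : 0 ≤ θ - m := by linarith
    have h2 : θ * n ≤ 0 := by nlinarith
    nlinarith
  -- If y ≥ 1, then y(ny+θ-m) ≥ n+θ-m > θ, contradicting the quadratic.
  have hy1 : y < 1 := by
    by_contra hcon
    push Not at hcon
    have h1 : (n : ℝ) ≤ n * y := by nlinarith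
    have h2 : n * y + (θ - m) ≤ y * (n * y + (θ - m)) :=
      le_mul_of_one_le_left (by linarith) hcon
    nlinarith
  have hxy : 1 - 2 * ((1 - y) / 2) = y := by ring
  have h1y : 1 - y ≠ 0 := by linarith
  rw [ht]
  refine ⟨⟨by linarith, by linarith⟩, ?_⟩
  rw [chiSqCgfDeriv, hxy]
  field_simp
  linear_combination -hroot

/-- τ is arbitrary because exp(-τ/2) occurs in both numerator and denominator. -/
theorem limitRE_eq {n m : ℕ} (hm : 1 ≤ m) (hmn : m < n) {θ : ℝ} (hθ : 0 ≤ θ) (τ : ℝ) :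
    limitRE n m θ = ratioIntegral (m / 2) (((n : ℝ) - m) / 2) θ τ 0 / (((n : ℝ) - m) / 2) /
      (chiSqMgf (m / 2) θ (tZero n m θ) *
        ((2 * tZero n m θ) ^ (-(((n : ℝ) - m) / 2)) * Real.exp (-(τ / 2))) *
        (√(2 * Real.pi))⁻¹ * (√(tZero n m θ ^ 2 * chiSqCgfDeriv2 (m / 2) θ (tZero n m θ) +
          ((n : ℝ) - m) / 2))⁻¹) := by
  obtain ⟨⟨ht0, ht1⟩, -⟩ := tZero_spec hm hmn hθ
  have hm0 : (0 : ℝ) < m := by exact_mod_cast hm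
  have hmn0 : (m : ℝ) < n := by exact_mod_cast hmn
  have hy : 0 < 1 - 2 * tZero n m θ := by linarith
  have hb : 0 < ((n : ℝ) - m) / 2 := by linarith
  have hU : uZero n m θ = √(tZero n m θ ^ 2 * chiSqCgfDeriv2 (m / 2) θ (tZero n m θ) +
      ((n : ℝ) - m) / 2) := by
    rw [uZero, chiSqCgfDeriv2]
    congr 1
    ring
  have hE : Real.exp (-etaTwo n m θ) = Real.exp (-(θ / 2)) *
      (Real.exp (θ * tZero n m θ / (1 - 2 * tZero n m θ)))⁻¹ := by
    rw [← Real.exp_neg, ← Real.exp_add, etaTwo]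
    congr 1
    field_simp
    ring
  rw [limitRE, hE, ← hU, ratioIntegral_zero (by linarith) hb hθ,
    show (m : ℝ) / 2 + ((n : ℝ) - m) / 2 = n / 2 by ring, chiSqMgf, Real.rpow_neg hy.le,
    Real.rpow_neg (by positivity)]
  have hB := (beta_pos (show (0 : ℝ) < m / 2 by linarith) hb).ne'
  have h1 : (1 - 2 * tZero n m θ) ^ ((m : ℝ) / 2) ≠ 0 := (Real.rpow_pos_of_pos hy _).ne'
  have h2 : (2 * tZero n m θ) ^ (((n : ℝ) - m) / 2) ≠ 0 :=
    (Real.rpow_pos_of_pos (by positivity) _).ne'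
  have h3 : Real.exp (-(τ / 2)) ≠ 0 := (Real.exp_pos _).ne'
  simp only [div_eq_mul_inv, mul_inv, inv_inv]
  simp only [← div_eq_mul_inv]
  generalize kummer (n / 2) (m / 2) (θ / 2) = κ
  generalize uZero n m θ = u
  generalize √(2 * Real.pi) = p
  generalize (2 * tZero n m θ) ^ (((n : ℝ) - m) / 2) = v at *
  generalize (1 - 2 * tZero n m θ) ^ ((m : ℝ) / 2) = z at *
  generalize beta ((m : ℝ) / 2) (((n : ℝ) - m) / 2) = B at *
  generalize Real.exp (-(τ / 2)) = e at *
  have h4 : ((n : ℝ) - m) ≠ 0 := by linarith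
  field_simp

/-! ### Limits of the two approximations and of the exact quantities -/

theorem uHat_limit_pos {n m : ℕ} (hm : 1 ≤ m) (hmn : m < n) {θ : ℝ} (hθ : 0 ≤ θ) :
    0 < √(tZero n m θ ^ 2 * chiSqCgfDeriv2 (m / 2) θ (tZero n m θ) + ((n : ℝ) - m) / 2) := by
  obtain ⟨⟨ht0, ht1⟩, -⟩ := tZero_spec hm hmn hθ
  have h2 : (m : ℝ) < n := by exact_mod_cast hmn
  have h3 : 0 < 1 - 2 * tZero n m θ := by linarith
  have h4 : 0 ≤ chiSqCgfDeriv2 (m / 2) θ (tZero n m θ) := by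
    unfold chiSqCgfDeriv2
    positivity
  have h5 : 0 < ((n : ℝ) - m) / 2 := by linarith
  positivity

section

variable {n m : ℕ} {Ω : Type*} [MeasurableSpace Ω] {P : Measure Ω}
  {μ : Fin n → ℝ} {ε : Fin n → Ω → ℝ} (hm : 1 ≤ m) (hmn : m < n) (hε : IsGaussianVector ε μ P)
include hm hmn hε

theorem hasDensity_ratio_beta [IsProbabilityMeasure P] :
    IsContinuousDensityOn (ratio (betaA n m) 1 ε) P (Ioo 0 1)
      (ratioDensity (m / 2) (((n : ℝ) - m) / 2) (theta m μ) (thetaTail m μ)) := by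
  have h1 : (0 : ℝ) < m / 2 := by
    have : (0 : ℝ) < m := by exact_mod_cast hm
    positivity
  have h2 : (0 : ℝ) < ((n : ℝ) - m) / 2 := by
    have : (m : ℝ) < n := by exact_mod_cast hmn
    linarith
  have hθ := theta_nonneg m μ
  have hτ := thetaTail_nonneg m μ
  refine ⟨measurable_ratioDensity h1 h2 hθ hτ, ratioDensity_nonneg h1 h2 hθ hτ,
    continuousOn_ratioDensity h1 h2 hθ hτ, ?_⟩
  have l1 : HasLaw (sqSum ε (headCoords n m)) (chiSqLaw (m / 2) (theta m μ)) P :=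
    hasLaw_chiSqLaw (hε.aemeasurable_sqSum _) h1 hθ fun t ht => by
      rw [hε.mgf_sqSum _ ht, card_headCoords hmn.le]; rfl
  have l2 : HasLaw (sqSum ε (tailCoords n m)) (chiSqLaw (((n : ℝ) - m) / 2) (thetaTail m μ)) P :=
    hasLaw_chiSqLaw (hε.aemeasurable_sqSum _) h2 hτ fun t ht => by
      rw [hε.mgf_sqSum _ ht, card_tailCoords hmn.le, Nat.cast_sub hmn.le]; rfl
  rw [funext (ratio_beta m ε)]
  exact hasLaw_ratioDensity h1 h2 hθ hτ l1 l2 (hε.indepFun_sqSum (disjoint_coords n m))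

theorem measureReal_lt_ratio_beta [IsProbabilityMeasure P] (r : ℝ) :
    P.real {ω | r < ratio (betaA n m) 1 ε ω} = ∫ x in Ioc r 1,
      ratioDensity (m / 2) (((n : ℝ) - m) / 2) (theta m μ) (thetaTail m μ) x := by
  have hf := hasDensity_ratio_beta hm hmn hε
  rw [hf.law.measureReal_eq (p := fun x => r < x) measurableSet_Ioi,
    ← setIntegral_eq_of_subset_of_forall_sdiff_eq_zero measurableSet_Ioi Ioc_subset_Ioi_self,
    integral_eq_lintegral_of_nonneg_ae (Eventually.of_forall hf.nonneg)
      hf.measurable.aestronglyMeasurable]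
  · rw [show {x | r < x} = Ioi r from rfl, measureReal_def, withDensity_apply _ measurableSet_Ioi]
  · intro x hx
    refine indicator_of_notMem (fun h => hx.2 ⟨hx.1, h.2.le⟩) _

theorem tendsto_scaled_saddlepoint_beta :
    Tendsto (fun r => (1 - r) * saddlepoint (betaA n m) 1 ε P r) (𝓝[<] 1)
      (𝓝 (tZero n m (theta m μ))) := by
  have h1 : (0 : ℝ) < m := by exact_mod_cast hm
  have h2 : (m : ℝ) < n := by exact_mod_cast hmn
  obtain ⟨k1, k2⟩ := tZero_spec hm hmn (theta_nonneg m μ)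
  exact tendsto_scaled_saddlepoint (by linarith) (by linarith) (theta_nonneg m μ)
    (thetaTail_nonneg m μ) k1 k2 fun r hr => (isSaddlepoint_beta_iff hm hmn hε hr).mp
      (isSaddlepoint_saddlepoint_beta hm hmn hε hr)

theorem tendsto_mgf_saddlepoint_beta :
    Tendsto (fun r => mgf (formX (betaA n m) 1 ε r) P (saddlepoint (betaA n m) 1 ε P r) /
      (1 - r) ^ (((n : ℝ) - m) / 2)) (𝓝[<] 1)
      (𝓝 (chiSqMgf (m / 2) (theta m μ) (tZero n m (theta m μ)) *
        ((2 * tZero n m (theta m μ)) ^ (-(((n : ℝ) - m) / 2)) *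
          Real.exp (-(thetaTail m μ / 2))))) := by
  refine (tendsto_saddleMgf_div (tZero_spec hm hmn (theta_nonneg m μ)).1
    (tendsto_scaled_saddlepoint_beta hm hmn hε)).congr' ?_
  filter_upwards [Ioo_mem_nhdsLT (zero_lt_one (α := ℝ))] with r hr
  rw [mgf_formX_beta hm hmn hε hr (isSaddlepoint_saddlepoint_beta hm hmn hε hr).1]

theorem tendsto_uHat_beta :
    Tendsto (uHat (betaA n m) 1 ε P) (𝓝[<] 1)
      (𝓝 (√(tZero n m (theta m μ) ^ 2 *
        chiSqCgfDeriv2 (m / 2) (theta m μ) (tZero n m (theta m μ)) + ((n : ℝ) - m) / 2))) := by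
  obtain ⟨ht0, -⟩ := tZero_spec hm hmn (theta_nonneg m μ)
  have ht := tendsto_scaled_saddlepoint_beta hm hmn hε
  refine ((tendsto_saddleCurv (τ := thetaTail m μ) ht0 ht).sqrt).congr' ?_
  filter_upwards [Ioo_mem_nhdsLT (zero_lt_one (α := ℝ)), ht.eventually_const_lt ht0.1] with r hr hp
  have hs : 0 < saddlepoint (betaA n m) 1 ε P r :=
    pos_of_mul_pos_right hp (by linarith [hr.2])
  rw [uHat, iteratedDeriv_two_cumulant_beta hm hmn hε hr
    (isSaddlepoint_saddlepoint_beta hm hmn hε hr).1, Real.sqrt_mul (sq_nonneg _),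
    Real.sqrt_sq hs.le]

theorem tendsto_lugannaniRiceTail_beta [IsProbabilityMeasure P] :
    Tendsto (fun r => lugannaniRiceTail (betaA n m) 1 ε P r / (1 - r) ^ (((n : ℝ) - m) / 2))
      (𝓝[<] 1)
      (𝓝 (chiSqMgf (m / 2) (theta m μ) (tZero n m (theta m μ)) *
        ((2 * tZero n m (theta m μ)) ^ (-(((n : ℝ) - m) / 2)) *
          Real.exp (-(thetaTail m μ / 2))) * (√(2 * Real.pi))⁻¹ *
        (√(tZero n m (theta m μ) ^ 2 *
          chiSqCgfDeriv2 (m / 2) (theta m μ) (tZero n m (theta m μ)) +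
            ((n : ℝ) - m) / 2))⁻¹)) := by
  have hθ := theta_nonneg m μ
  obtain ⟨ht0, -⟩ := tZero_spec hm hmn hθ
  have h2 : (m : ℝ) < n := by exact_mod_cast hmn
  have hb : 0 < ((n : ℝ) - m) / 2 := by linarith
  have ht := tendsto_scaled_saddlepoint_beta hm hmn hε
  have hM := tendsto_mgf_saddlepoint_beta hm hmn hε
  have hpow : Tendsto (fun r : ℝ => (1 - r) ^ (((n : ℝ) - m) / 2)) (𝓝[<] 1) (𝓝 0) := by
    have h : ContinuousAt (fun r : ℝ => (1 - r) ^ (((n : ℝ) - m) / 2)) 1 :=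
      ContinuousAt.rpow_const (by fun_prop) (Or.inr hb.le)
    have := h.tendsto.mono_left (nhdsWithin_le_nhds (s := Iio 1))
    rwa [sub_self, Real.zero_rpow hb.ne'] at this
  have hMpos : ∀ᶠ r in 𝓝[<] (1 : ℝ),
      0 < mgf (formX (betaA n m) 1 ε r) P (saddlepoint (betaA n m) 1 ε P r) := by
    filter_upwards [Ioo_mem_nhdsLT (zero_lt_one (α := ℝ))] with r hr
    have hsp := isSaddlepoint_saddlepoint_beta hm hmn hε hr
    obtain ⟨k1, k2⟩ := (mem_strip_beta hm hmn hr).mp hsp.1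
    rw [mgf_formX_beta hm hmn hε hr hsp.1]
    exact saddleMgf_pos _ _ _ _ k1 k2
  have hMzero : Tendsto (fun r => mgf (formX (betaA n m) 1 ε r) P
      (saddlepoint (betaA n m) 1 ε P r)) (𝓝[<] 1) (𝓝[>] 0) := by
    refine tendsto_nhdsWithin_iff.mpr ⟨?_, hMpos⟩
    have := hM.mul hpow
    rw [mul_zero] at this
    refine this.congr' ?_
    filter_upwards [self_mem_nhdsWithin] with r hr
    have : 0 < 1 - r := by linarith [mem_Iio.mp hr]
    exact div_mul_cancel₀ _ (Real.rpow_pos_of_pos this _).ne'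
  have hK : Tendsto (fun r => cumulant (betaA n m) 1 ε P r (saddlepoint (betaA n m) 1 ε P r))
      (𝓝[<] 1) atBot := Real.tendsto_log_nhdsGT_zero.comp hMzero
  have hsign : ∀ᶠ r in 𝓝[<] (1 : ℝ), 0 < saddlepoint (betaA n m) 1 ε P r := by
    filter_upwards [self_mem_nhdsWithin, ht.eventually_const_lt ht0.1] with r hr hp
    exact pos_of_mul_pos_right hp (by linarith [mem_Iio.mp hr])
  have hw : Tendsto (wHat (betaA n m) 1 ε P) (𝓝[<] 1) atTop := by
    have h := Real.tendsto_sqrt_atTop.comp (hK.const_mul_atBot_of_neg (by norm_num : (-2 : ℝ) < 0))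
    refine h.congr' ?_
    filter_upwards [hsign] with r hr
    rw [wHat, Real.sign_of_pos hr, one_mul]
    rfl
  have hLR := tendsto_lugannaniRice_tail (uHat_limit_pos hm hmn hθ).ne' hw
    (tendsto_uHat_beta hm hmn hε)
  have hfin := (hM.mul_const (√(2 * Real.pi))⁻¹).mul hLR
  refine hfin.congr' ?_
  filter_upwards [Ioo_mem_nhdsLT (zero_lt_one (α := ℝ)), hsign, hMpos, hK.eventually_le_atBot 0]
    with r hr hs hMr hKr
  have hne : ∫ ω, formX (betaA n m) 1 ε r ω ∂P ≠ 0 := fun h =>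
    hs.ne' (saddlepoint_eq_zero_of_integral_eq_zero hm hmn hε hr h)
  -- exp(-ŵ²/2) = exp(K(ŝ)) = M(ŝ), where K(ŝ) ≤ 0 is needed to square the root.
  have hpdf : gaussianPDFReal 0 1 (wHat (betaA n m) 1 ε P r) =
      mgf (formX (betaA n m) 1 ε r) P (saddlepoint (betaA n m) 1 ε P r) *
        (√(2 * Real.pi))⁻¹ := by
    have hsq : wHat (betaA n m) 1 ε P r ^ 2 =
        -2 * cumulant (betaA n m) 1 ε P r (saddlepoint (betaA n m) 1 ε P r) := by
      rw [wHat, Real.sign_of_pos hs, one_mul, Real.sq_sqrt (by linarith)]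
    rw [gaussianPDFReal, sub_zero, hsq, mul_comm]
    simp only [NNReal.coe_one, mul_one]
    rw [show -(-2 * cumulant (betaA n m) 1 ε P r (saddlepoint (betaA n m) 1 ε P r)) / 2 =
      cumulant (betaA n m) 1 ε P r (saddlepoint (betaA n m) 1 ε P r) by ring, cumulant, cgf,
      Real.exp_log hMr]
  rw [lugannaniRiceTail, lugannaniRice, if_neg hne, hpdf]
  have h5 : √(2 * Real.pi) ≠ 0 := by positivity
  have h6 := hMr.ne'
  field_simp

theorem tendsto_saddleDensity_beta :
    Tendsto (fun r => saddleDensity (betaA n m) 1 μ ε P r / (1 - r) ^ (((n : ℝ) - m) / 2 - 1))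
      (𝓝[<] 1)
      (𝓝 (((n : ℝ) - m) / 2 * (chiSqMgf (m / 2) (theta m μ) (tZero n m (theta m μ)) *
        ((2 * tZero n m (theta m μ)) ^ (-(((n : ℝ) - m) / 2)) *
          Real.exp (-(thetaTail m μ / 2))) * (√(2 * Real.pi))⁻¹ *
        (√(tZero n m (theta m μ) ^ 2 *
          chiSqCgfDeriv2 (m / 2) (theta m μ) (tZero n m (theta m μ)) +
            ((n : ℝ) - m) / 2))⁻¹))) := by
  have hθ := theta_nonneg m μ
  obtain ⟨ht0, hteq⟩ := tZero_spec hm hmn hθ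
  have ht := tendsto_scaled_saddlepoint_beta hm hmn hε
  have hM := tendsto_mgf_saddlepoint_beta hm hmn hε
  have hu := (tendsto_uHat_beta hm hmn hε).inv₀ (uHat_limit_pos hm hmn hθ).ne'
  have hr1 : Tendsto (fun r : ℝ => r) (𝓝[<] 1) (𝓝 1) := tendsto_id.mono_left nhdsWithin_le_nhds
  -- This is the limit of J_r(ŝ)·(1-r)ŝ, namely (b/t₀)·t₀ = b.
  have hJ := (((continuousAt_chiSqCgfDeriv (m / 2) (theta m μ) ht0.2).tendsto.comp ht).div hr1
    one_ne_zero).mul ht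
  rw [hteq, div_one, div_mul_cancel₀ _ ht0.1.ne'] at hJ
  refine (hJ.mul ((hM.mul_const (√(2 * Real.pi))⁻¹).mul hu)).congr' ?_
  filter_upwards [Ioo_mem_nhdsLT (zero_lt_one (α := ℝ)), ht.eventually_const_lt ht0.1]
    with r hr hp
  have h0 := hr.1
  have h1 : 0 < 1 - r := by linarith [hr.2]
  have hs : 0 < saddlepoint (betaA n m) 1 ε P r := pos_of_mul_pos_right hp h1.le
  have hsp := isSaddlepoint_saddlepoint_beta hm hmn hε hr
  obtain ⟨⟨k1, k2⟩, k3⟩ := (isSaddlepoint_beta_iff hm hmn hε hr).mp hsp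
  simp only [Pi.div_apply, Function.comp_apply]
  rw [saddleDensity, uHat, saddleFactor_beta hmn.le μ k1 k2,
    Real.sqrt_mul (by positivity : 0 ≤ 2 * Real.pi),
    Real.rpow_sub_one h1.ne']
  -- The saddlepoint equation says that (1-r) times the Y-slope equals r times the Z-slope, so their
  -- sum is the Y-slope over r.
  have hJ' : chiSqCgfDeriv (m / 2) (theta m μ) ((1 - r) * saddlepoint (betaA n m) 1 ε P r) +
      chiSqCgfDeriv (((n : ℝ) - m) / 2) (thetaTail m μ) (-(r * saddlepoint (betaA n m) 1 ε P r)) =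
      chiSqCgfDeriv (m / 2) (theta m μ) ((1 - r) * saddlepoint (betaA n m) 1 ε P r) / r := by
    unfold saddleSlope at k3
    rw [eq_div_iff h0.ne']
    linarith
  rw [hJ']
  have h5 : √(2 * Real.pi) ≠ 0 := by positivity
  have h6 : (1 - r) ^ (((n : ℝ) - m) / 2) ≠ 0 := (Real.rpow_pos_of_pos h1 _).ne'
  have h7 := hs.ne'
  have h8 := h1.ne'
  field_simp

end

end QuadRatio

/-! ### Comparison of exact and approximate edge constants -/

theorem theorem15 {n m : ℕ} (hm : 1 ≤ m) (hmn : 1 ≤ n - m) (μ : Fin n → ℝ)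
    {Ω : Type*} [MeasurableSpace Ω] (P : Measure Ω) [IsProbabilityMeasure P]
    (ε : Fin n → Ω → ℝ) (hε : IsGaussianVector ε μ P) :
    (∀ r ∈ Ioo (0 : ℝ) 1, ∃! s, IsSaddlepoint (betaA n m) 1 ε P r s) ∧
    Tendsto
      (fun r => P.real {ω | r < ratio (betaA n m) 1 ε ω} / lugannaniRiceTail (betaA n m) 1 ε P r)
      (𝓝[<] 1) (𝓝 (limitRE n m (theta m μ))) ∧
    (∃ f, IsContinuousDensityOn (ratio (betaA n m) 1 ε) P (Ioo 0 1) f) ∧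
    ∀ f, IsContinuousDensityOn (ratio (betaA n m) 1 ε) P (Ioo 0 1) f →
      Tendsto (fun r => f r / saddleDensity (betaA n m) 1 μ ε P r)
        (𝓝[<] 1) (𝓝 (limitRE n m (theta m μ))) := by
  have hlt : m < n := by omega
  have hm0 : (0 : ℝ) < m := by exact_mod_cast hm
  have hn0 : (m : ℝ) < n := by exact_mod_cast hlt
  have ha : (0 : ℝ) < m / 2 := by linarith
  have hb : (0 : ℝ) < ((n : ℝ) - m) / 2 := by linarith
  have hθ := theta_nonneg m μ
  have hτ := thetaTail_nonneg m μ
  have hdens := hasDensity_ratio_beta hm hlt hε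
  have hlim := tendsto_ratioDensity_div ha hb hθ hτ
  obtain ⟨⟨ht0, ht1⟩, -⟩ := tZero_spec hm hlt hθ
  have hne : chiSqMgf (m / 2) (theta m μ) (tZero n m (theta m μ)) *
        ((2 * tZero n m (theta m μ)) ^ (-(((n : ℝ) - m) / 2)) *
          Real.exp (-(thetaTail m μ / 2))) * (√(2 * Real.pi))⁻¹ *
        (√(tZero n m (theta m μ) ^ 2 *
          chiSqCgfDeriv2 (m / 2) (theta m μ) (tZero n m (theta m μ)) +
            ((n : ℝ) - m) / 2))⁻¹ ≠ 0 := by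
    have h1 := chiSqMgf_pos (m / 2) (theta m μ) ht1
    have h2 := uHat_limit_pos hm hlt hθ
    positivity
  have hRE := limitRE_eq hm hlt hθ (thetaTail m μ)
  refine ⟨fun r hr => existsUnique_isSaddlepoint_beta hm hlt hε hr, ?_, ⟨_, hdens⟩, ?_⟩
  · rw [hRE]
    refine ((tendsto_integral_tail_div hb hdens.measurable hlim).div
      (tendsto_lugannaniRiceTail_beta hm hlt hε) hne).congr' ?_
    filter_upwards [Ioo_mem_nhdsLT (zero_lt_one (α := ℝ))] with r hr
    rw [measureReal_lt_ratio_beta hm hlt hε r]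
    exact div_div_div_cancel_right₀ (Real.rpow_pos_of_pos (by linarith [hr.2]) _).ne' _ _
  · intro f hf
    -- This regroups (I(0)/b)/C as I(0)/(bC), the quotient of the two density constants.
    rw [hRE, div_div]
    refine (hlim.div (tendsto_saddleDensity_beta hm hlt hε) (mul_ne_zero hb.ne' hne)).congr' ?_
    filter_upwards [Ioo_mem_nhdsLT (zero_lt_one (α := ℝ))] with r hr
    rw [hf.eqOn isOpen_Ioo hdens hr]
    exact div_div_div_cancel_right₀ (Real.rpow_pos_of_pos (by linarith [hr.2]) _).ne' _ _
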